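/- Let $n\ge 1$, let $\mathcal L=-\Delta$ on $\mathbb R^n$ and, with $\widehat f(\xi)=\int_{\mathbb R^n} e^{-2\pi i x\cdot\xi}f(x)\,dx$, let $\mathcal U^{1/2}=\mathcal L^{1/2}(\mathcal I+\mathcal L)^{-1/2}$ and $\mathcal R=\nabla\mathcal L^{-1/2}$ be the operators from $L^1(\mathbb R^n)$ to tempered distributions with Fourier multipliers $\frac{2\pi|\xi|}{\sqrt{1+4\pi^2|\xi|^2}}$ and $\frac{i\xi}{|\xi|}$ respectively. The Hardy space is $H^1(\mathbb R^n)=\{f\in L^1(\mathbb R^n): |\mathcal R f|\in L^1(\mathbb R^n)\}$, with norm $\|f\|_{H^1}=\|f\|_1+\||\mathcal R f|\|_1$. An $\mathfrak h^1$-atom is a (complex-valued) function $a\in L^1(\mathbb R^n)$, supported in a ball $B$, with $\|a\|_2\le |B|^{-1/2}$, such that either $B$ has radius at most one and $\int_B a=0$, or $B$ has radius exactly one. The Goldberg space $\mathfrak h^1(\mathbb R^n)$ is the space of all $f\in L^1(\mathbb R^n)$ of the form $f=\sum_j\lambda_j a_j$ (convergence in $L^1$) with $\mathfrak h^1$-atoms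 $a_j$ and $\sum_j|\lambda_j|<\infty$; its norm $\|f\|_{\mathfrak h^1}$ is the infimum of $\sum_j|\lambda_j|$ over all such decompositions. Then $\mathcal U^{1/2}$ maps $\mathfrak h^1(\mathbb R^n)$ into $H^1(\mathbb R^n)$ and, as a linear operator between these spaces, is bounded (there is a constant $C$ such that $\|\mathcal U^{1/2}g\|_{H^1}\le C\|g\|_{\mathfrak h^1}$ for all $g\in\mathfrak h^1(\mathbb R^n)$) and injective, but not surjective. Thus $\mathcal U^{1/2}[\mathfrak h^1(\mathbb R^n)]$ is a proper subset of $H^1(\mathbb R^n)$. -/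

import Mathlib

open MeasureTheory FourierTransform
open scoped SchwartzMap ENNReal NNReal

noncomputable section

namespace EuclideanHardy

/-- The Lebesgue space `L¹(ℝⁿ)` of complex-valued functions (modulo a.e. equality). -/
abbrev L1 (n : ℕ) : Type := Lp ℂ 1 (volume : Measure (EuclideanSpace ℝ (Fin n)))

/-! ### Fourier multiplier operators on `L¹(ℝⁿ)` -/

section Multiplier

variable {n : ℕ} {F : Type} [NormedAddCommGroup F] [NormedSpace ℂ F]

theorem memLp_fourier_smul {m : EuclideanSpace ℝ (Fin n) → F}
    (hm : MemLp m ∞ (volume : Measure (EuclideanSpace ℝ (Fin n)))) (f : L1 n) :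
    MemLp (fun ξ => Real.Lp.fourierTransformCLM (EuclideanSpace ℝ (Fin n)) ℂ f ξ • m ξ) ∞
      (volume : Measure (EuclideanSpace ℝ (Fin n))) := by
  have h : MemLp (fun ξ => Real.Lp.fourierTransformCLM (EuclideanSpace ℝ (Fin n)) ℂ f ξ) ∞
      (volume : Measure (EuclideanSpace ℝ (Fin n))) :=
    memLp_top_of_bound (Real.Lp.fourierTransformCLM (EuclideanSpace ℝ (Fin n)) ℂ f).continuous.aestronglyMeasurable
      ‖Real.Lp.fourierTransformCLM (EuclideanSpace ℝ (Fin n)) ℂ f‖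
      (Filter.Eventually.of_forall fun x => (Real.Lp.fourierTransformCLM (EuclideanSpace ℝ (Fin n)) ℂ f).norm_coe_le_norm x)
  exact hm.smul h

variable [CompleteSpace F]

/-- The Fourier multiplier operator with bounded symbol `m`, mapping `f ∈ L¹(ℝⁿ)` to the tempered
distribution `𝓕⁻¹ (m · 𝓕 f)`. Here `𝓕 f (ξ) = ∫ exp (-2πi x·ξ) f(x) dx`, and `m` may be
vector-valued. -/
def fourierMultiplier (m : EuclideanSpace ℝ (Fin n) → F)
    (hm : MemLp m ∞ (volume : Measure (EuclideanSpace ℝ (Fin n)))) :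
    L1 n →ₗ[ℂ] 𝓢'(EuclideanSpace ℝ (Fin n), F) where
  toFun f := 𝓕⁻ (Lp.toTemperedDistributionCLM F volume ∞ (memLp_fourier_smul hm f).toLp)
  map_add' f g := by
    rw [← fourierInv_add, ← map_add, ← MemLp.toLp_add]
    congr 2
    apply MemLp.toLp_congr
    refine Filter.Eventually.of_forall fun ξ => ?_
    simp only [map_add, BoundedContinuousFunction.coe_add, Pi.add_apply, add_smul]
  map_smul' c f := by
    rw [RingHom.id_apply, ← fourierInv_smul, ← map_smul, ← MemLp.toLp_const_smul]
    congr 2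
    apply MemLp.toLp_congr
    refine Filter.Eventually.of_forall fun ξ => ?_
    simp only [map_smul, BoundedContinuousFunction.coe_smul, Pi.smul_apply, smul_assoc]

end Multiplier

/-! ### The operators `𝓤^{1/2} = 𝓛^{1/2} (I + 𝓛)^{-1/2}` and `𝓡 = ∇ 𝓛^{-1/2}`, where `𝓛 = -Δ` -/

/-- The Fourier symbol `4π²|ξ|²` of `𝓛 = -Δ`. -/
def lapSymbol {n : ℕ} (ξ : EuclideanSpace ℝ (Fin n)) : ℝ := (2 * Real.pi * ‖ξ‖) ^ 2

/-- The Fourier symbol of `𝓛^{1/2} (I + 𝓛)^{-1/2}`. -/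
def uHalfSymbol {n : ℕ} (ξ : EuclideanSpace ℝ (Fin n)) : ℂ :=
  ((lapSymbol ξ ^ (1 / 2 : ℝ) * (1 + lapSymbol ξ) ^ (-(1 / 2) : ℝ) : ℝ) : ℂ)

/-- The (vector-valued) Fourier symbol `2πi ξ (4π²|ξ|²)^{-1/2}` of the Riesz transform
`𝓡 = ∇ 𝓛^{-1/2}`; its value at `ξ = 0` is immaterial. -/
def rieszSymbol {n : ℕ} (ξ : EuclideanSpace ℝ (Fin n)) : EuclideanSpace ℂ (Fin n) :=
  WithLp.toLp 2 fun j =>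
    2 * Real.pi * Complex.I * (ξ j : ℂ) * ((lapSymbol ξ ^ (-(1 / 2) : ℝ) : ℝ) : ℂ)

theorem lapSymbol_nonneg {n : ℕ} (ξ : EuclideanSpace ℝ (Fin n)) : 0 ≤ lapSymbol ξ := sq_nonneg _

theorem memLp_uHalfSymbol (n : ℕ) :
    MemLp (uHalfSymbol (n := n)) ∞ (volume : Measure (EuclideanSpace ℝ (Fin n))) := by
  refine memLp_top_of_bound (Measurable.aestronglyMeasurable ?_) 1
    (Filter.Eventually.of_forall fun ξ => ?_)
  · unfold uHalfSymbol lapSymbol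
    fun_prop
  · have h := lapSymbol_nonneg ξ
    have h1 : (0 : ℝ) < 1 + lapSymbol ξ := by linarith
    have h2 : 0 ≤ (1 + lapSymbol ξ) ^ (-(1 / 2) : ℝ) := Real.rpow_nonneg h1.le _
    have h3 : 0 ≤ lapSymbol ξ ^ (1 / 2 : ℝ) := Real.rpow_nonneg h _
    rw [uHalfSymbol, Complex.norm_real, Real.norm_eq_abs, abs_of_nonneg (mul_nonneg h3 h2)]
    calc lapSymbol ξ ^ (1 / 2 : ℝ) * (1 + lapSymbol ξ) ^ (-(1 / 2) : ℝ)
        ≤ (1 + lapSymbol ξ) ^ (1 / 2 : ℝ) * (1 + lapSymbol ξ) ^ (-(1 / 2) : ℝ) := by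
          refine mul_le_mul_of_nonneg_right ?_ h2
          exact Real.rpow_le_rpow h (by linarith) (by norm_num)
      _ = 1 := by rw [← Real.rpow_add h1]; norm_num

theorem memLp_rieszSymbol (n : ℕ) :
    MemLp (rieszSymbol (n := n)) ∞ (volume : Measure (EuclideanSpace ℝ (Fin n))) := by
  refine memLp_top_of_bound (Measurable.aestronglyMeasurable ?_) 1
    (Filter.Eventually.of_forall fun ξ => ?_)
  · unfold rieszSymbol lapSymbol
    refine (WithLp.measurable_toLp 2 _).comp ?_
    refine measurable_pi_lambda _ fun j => ?_
    fun_prop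
  · have hp : 0 < 2 * Real.pi := by positivity
    have hl : lapSymbol ξ ^ (-(1 / 2) : ℝ) = (2 * Real.pi * ‖ξ‖)⁻¹ := by
      have h0 : 0 ≤ 2 * Real.pi * ‖ξ‖ := by positivity
      rw [lapSymbol, ← Real.rpow_natCast, ← Real.rpow_mul h0]
      norm_num
      rw [Real.rpow_neg_one, mul_inv, mul_inv]
      ring
    have he : rieszSymbol ξ =
        (2 * Real.pi * Complex.I * (((2 * Real.pi * ‖ξ‖)⁻¹ : ℝ) : ℂ)) •
          (WithLp.toLp 2 fun j => (ξ j : ℂ) : EuclideanSpace ℂ (Fin n)) := by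
      ext j
      simp only [rieszSymbol, hl, PiLp.smul_apply, smul_eq_mul]
      ring
    have hn : ‖(WithLp.toLp 2 fun j => (ξ j : ℂ) : EuclideanSpace ℂ (Fin n))‖ = ‖ξ‖ := by
      simp [EuclideanSpace.norm_eq]
    have hc : ‖(2 * Real.pi * Complex.I * (((2 * Real.pi * ‖ξ‖)⁻¹ : ℝ) : ℂ))‖
        = 2 * Real.pi * (2 * Real.pi * ‖ξ‖)⁻¹ := by
      rw [norm_mul, norm_mul, norm_mul, Complex.norm_I, Complex.norm_real, Complex.norm_real,
        Real.norm_of_nonneg Real.pi_pos.le, Real.norm_of_nonneg (by positivity)]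
      norm_num
    rw [he, norm_smul, hn, hc]
    by_cases h : ‖ξ‖ = 0
    · simp [h]
    · have := Real.pi_pos.ne'
      refine le_of_eq ?_
      field_simp

/-- The operator `𝓤^{1/2} = 𝓛^{1/2} (I + 𝓛)^{-1/2}` on `L¹(ℝⁿ)`. -/
def uHalf (n : ℕ) : L1 n →ₗ[ℂ] 𝓢'(EuclideanSpace ℝ (Fin n), ℂ) :=
  fourierMultiplier uHalfSymbol (memLp_uHalfSymbol n)

/-- The vector of Riesz transforms `𝓡 = ∇ 𝓛^{-1/2}` on `L¹(ℝⁿ)`. -/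
def riesz (n : ℕ) :
    L1 n →ₗ[ℂ] 𝓢'(EuclideanSpace ℝ (Fin n), EuclideanSpace ℂ (Fin n)) :=
  fourierMultiplier rieszSymbol (memLp_rieszSymbol n)

/-! ### The Hardy space `H¹(ℝⁿ)` -/

/-- The Hardy space `H¹(ℝⁿ) = {f ∈ L¹(ℝⁿ) : |𝓡 f| ∈ L¹(ℝⁿ)}`. -/
def H1 (n : ℕ) : Submodule ℂ (L1 n) :=
  Submodule.comap (riesz n)
    (Lp.toTemperedDistributionCLM (EuclideanSpace ℂ (Fin n))
      (volume : Measure (EuclideanSpace ℝ (Fin n))) 1).toLinearMap.range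

/-- The function in `L¹(ℝⁿ; ℂⁿ)` that represents the Riesz transform of `f ∈ H¹(ℝⁿ)`. -/
def rieszL1 {n : ℕ} (f : H1 n) :
    Lp (EuclideanSpace ℂ (Fin n)) 1 (volume : Measure (EuclideanSpace ℝ (Fin n))) :=
  Classical.choose f.2

theorem rieszL1_spec {n : ℕ} (f : H1 n) :
    Lp.toTemperedDistributionCLM (EuclideanSpace ℂ (Fin n)) volume 1 (rieszL1 f)
      = riesz n (f : L1 n) :=
  Classical.choose_spec f.2

/-- The norm `‖f‖_{H¹} = ‖f‖₁ + ‖ |𝓡 f| ‖₁`. -/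
def hardyNorm {n : ℕ} (f : H1 n) : ℝ := ‖(f : L1 n)‖ + ‖rieszL1 f‖

/-! ### The Goldberg space `𝔥¹(ℝⁿ)` -/

/-- Standard atoms: supported in a ball of radius at most one, with the `L²` size condition and
the cancellation condition. -/
def IsStandardAtom {n : ℕ} (a : L1 n) : Prop :=
  ∃ (c : EuclideanSpace ℝ (Fin n)) (r : ℝ), 0 < r ∧ r ≤ 1 ∧
    (∀ᵐ x, x ∉ Metric.ball c r → a x = 0) ∧
    eLpNorm a 2 volume ≤ volume (Metric.ball c r) ^ (-(1 / 2) : ℝ) ∧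
    ∫ x in Metric.ball c r, a x = 0

/-- Global atoms: supported in a ball of radius exactly one, with the `L²` size condition. -/
def IsGlobalAtom {n : ℕ} (a : L1 n) : Prop :=
  ∃ c : EuclideanSpace ℝ (Fin n),
    (∀ᵐ x, x ∉ Metric.ball c 1 → a x = 0) ∧
    eLpNorm a 2 volume ≤ volume (Metric.ball c 1) ^ (-(1 / 2) : ℝ)

/-- `𝔥¹(ℝⁿ)`-atoms. -/
def IsAtom {n : ℕ} (a : L1 n) : Prop := IsStandardAtom a ∨ IsGlobalAtom a

/-- `f = ∑ⱼ lⱼ aⱼ` (in `L¹`) with `𝔥¹(ℝⁿ)`-atoms `aⱼ` and `∑ⱼ |lⱼ| < ∞`. -/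
def IsAtomicDecomp {n : ℕ} (f : L1 n) (l : ℕ → ℂ) (a : ℕ → L1 n) : Prop :=
  (∀ j, IsAtom (a j)) ∧ Summable (fun j => ‖l j‖) ∧ HasSum (fun j => l j • a j) f

theorem isAtom_zero (n : ℕ) : IsAtom (0 : L1 n) := by
  refine Or.inr ⟨0, ?_, ?_⟩
  · filter_upwards [Lp.coeFn_zero ℂ 1 (volume : Measure (EuclideanSpace ℝ (Fin n)))] with x hx _
    exact hx
  · rw [eLpNorm_congr_ae (Lp.coeFn_zero ℂ 1 (volume : Measure (EuclideanSpace ℝ (Fin n))))]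
    simp

/-- The Goldberg space `𝔥¹(ℝⁿ)`: the functions in `L¹(ℝⁿ)` with an atomic decomposition. -/
def goldberg (n : ℕ) : Submodule ℂ (L1 n) where
  carrier := {f | ∃ l a, IsAtomicDecomp f l a}
  zero_mem' := ⟨0, 0, fun _ => isAtom_zero n, by simp, by simp⟩
  add_mem' := by
    rintro f g ⟨l, a, ha, hl, hf⟩ ⟨l', a', ha', hl', hg⟩
    refine ⟨fun j => Sum.elim l l' (Equiv.natSumNatEquivNat.symm j),
      fun j => Sum.elim a a' (Equiv.natSumNatEquivNat.symm j), fun j => ?_, ?_, ?_⟩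
    · change IsAtom (Sum.elim a a' (Equiv.natSumNatEquivNat.symm j))
      rcases Equiv.natSumNatEquivNat.symm j with i | i
      · exact ha i
      · exact ha' i
    · refine (Equiv.natSumNatEquivNat.symm.summable_iff
        (f := fun s => ‖Sum.elim l l' s‖)).2 ?_
      exact Summable.sum _ hl hl'
    · refine (Equiv.natSumNatEquivNat.symm.hasSum_iff
        (f := fun s => Sum.elim l l' s • Sum.elim a a' s)).2 ?_
      exact HasSum.sum hf hg
  smul_mem' := by
    rintro c f ⟨l, a, ha, hl, hf⟩
    refine ⟨fun j => c * l j, a, ha, ?_, ?_⟩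
    · simpa [norm_mul] using hl.mul_left ‖c‖
    · simpa [mul_smul] using hf.const_smul c

/-- The norm of `𝔥¹(ℝⁿ)`: the infimum of `∑ⱼ |lⱼ|` over all atomic decompositions of `f`. -/
def goldbergNorm {n : ℕ} (f : goldberg n) : ℝ :=
  sInf {s : ℝ | ∃ l a, IsAtomicDecomp (f : L1 n) l a ∧ s = ∑' j, ‖l j‖}

end EuclideanHardy

end

/-!
Write `s(ξ) = 4π²|ξ|²` for the symbol of `𝓛`. Both `𝓤^{1/2}` and `𝓡 𝓤^{1/2}` have a multiplier of
the form `m = (1 + s)^{-1/2} A` with `A` homogeneous of degree one, namely `A = √s` and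
`A = 2πi ξ`. If `ψ` is a function with `𝓕 ψ = e^{-s} A`, then the identity

  `(1 + s)^{-1/2} = ∫_{t > 0} (2/√π) e^{-(1 + s) t²} dt`

exhibits `m` as the limit, as `ε → 0`, of the Fourier transforms of the integrable kernels
`K_ε = ∫_{t > ε} (2/√π) e^{-t²} ψ_t dt/t`, where `ψ_t` is the `L¹`-normalised dilate of `ψ`
(`truncKernel`, `fourier_truncKernel`). All that is needed of `ψ` is that it is integrable, has a
finite moment of order `1/2`, and satisfies `‖ψ(· - h) - ψ‖₁ ≤ C |h|` (`IsProfile`). The moment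
controls the scales `t ≤ r` and the modulus of continuity the scales `t > r`, which gives the
Hörmander condition for `K_ε`, uniformly in `ε`; the factor `e^{-t²}` makes `K_ε` integrable at
infinity, again uniformly (`IsProfile.exists_isAtomKernel`). The Hörmander condition estimates
`K_ε * a` away from the support of an atom `a` with cancellation, integrability at infinity does so
for an atom on a ball of radius one, and Plancherel estimates it near the support. Passing to the
limit in `L²` and applying Fatou's lemma bounds the multiplier operator from atoms to `L¹`
(`exists_toTemperedDistributionCLM_eq_fourierMultiplier_of_isAtom`), and atomic decompositions are
then summed (`exists_of_isAtomicDecomp`).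

For `A = 2πi ξ` the function `ψ` is a Schwartz function. For `A = √s` it is not, because `√s` is not
smooth at the origin; it is obtained from the Schwartz function with Fourier transform `s e^{-s}` as
a superposition of its dilates to scales `√(1 + t²)`, by means of
`s^{-1/2} = ∫_{t > 0} (2/√π) e^{-s t²} dt` (`IsProfile.exists_div_sqrt`).

The operator `𝓤^{1/2}` is injective because its symbol vanishes only at `ξ = 0`. It is not
surjective because the symbol vanishes to exact order one there: the function `f` with Fourier
transform `ξ_i e^{-s}` belongs to `H¹`, but `f = 𝓤^{1/2} g` would force `𝓕 g` to jump at the origin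
along the `i`-th axis, whereas `𝓕 g` is continuous for every `g ∈ L¹`
(`exists_mem_H1_forall_ne`).
-/

noncomputable section

namespace EuclideanHardy

/-! ### Gaussian Schwartz functions -/

section Gaussian
variable {E : Type*} [NormedAddCommGroup E] [InnerProductSpace ℝ E]

theorem contDiff_gaussian (b : ℝ) :
    ContDiff ℝ ((⊤ : ℕ∞) : WithTop ℕ∞) (fun x : E => Real.exp (-(b * ‖x‖ ^ 2))) :=
  (contDiff_const.mul (contDiff_norm_sq ℝ)).neg.exp

theorem fderiv_gaussian (b : ℝ) :
    fderiv ℝ (fun x : E => Real.exp (-(b * ‖x‖ ^ 2))) =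
      fun x => Real.exp (-(b * ‖x‖ ^ 2)) • ((-(2 * b)) • innerSL ℝ (E := E)) x := by
  ext x y
  have h : HasFDerivAt (fun x : E => Real.exp (-(b * ‖x‖ ^ 2))) _ x :=
    (((hasStrictFDerivAt_norm_sq x).hasFDerivAt.const_mul b).neg).exp
  rw [h.fderiv]
  simp
  ring

/-- All derivatives of the Gaussian are rapidly decreasing, by strong induction on the order: the
derivative of the Gaussian is the Gaussian times a linear map, so Leibniz' rule bounds a derivative
by those of lower order times polynomials. -/
theorem gaussian_decay {b : ℝ} (hb : 0 < b) (n : ℕ) : ∀ k : ℕ, ∃ C : ℝ, ∀ x : E,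
    ‖x‖ ^ k * ‖iteratedFDeriv ℝ n (fun x : E => Real.exp (-(b * ‖x‖ ^ 2))) x‖ ≤ C := by
  induction n using Nat.strong_induction_on with
  | _ n ih =>
  intro k
  rcases n with _ | n
  · refine ⟨1 + k.factorial / b ^ k, fun x => ?_⟩
    rw [norm_iteratedFDeriv_zero, Real.norm_of_nonneg (Real.exp_nonneg _), Real.exp_neg,
      ← div_eq_mul_inv, div_le_iff₀ (Real.exp_pos _)]
    have h1 : 1 ≤ Real.exp (b * ‖x‖ ^ 2) := Real.one_le_exp (by positivity)
    have h2 := Real.pow_div_factorial_le_exp (b * ‖x‖ ^ 2) (by positivity) k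
    have h3 : ‖x‖ ^ k ≤ 1 + ‖x‖ ^ k * ‖x‖ ^ k := by
      nlinarith [sq_nonneg (‖x‖ ^ k - 1), norm_nonneg x]
    have h4 : ‖x‖ ^ k * ‖x‖ ^ k ≤ k.factorial / b ^ k * Real.exp (b * ‖x‖ ^ 2) := by
      rw [div_mul_eq_mul_div, le_div_iff₀ (by positivity)]
      rw [div_le_iff₀ (by positivity)] at h2
      calc _ = (b * ‖x‖ ^ 2) ^ k := by ring
        _ ≤ _ := h2
        _ = _ := by ring
    linarith
  · obtain ⟨l, D, hD, hL⟩ :=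
      (((-(2 * b)) • innerSL ℝ (E := E)).hasTemperateGrowth).norm_iteratedFDeriv_le_uniform n
    choose! C hC using ih
    refine ⟨∑ i ∈ Finset.range (n + 1), (n.choose i : ℝ) * (D * (2 ^ l * (C i k + C i (k + l)))),
      fun x => ?_⟩
    rw [← norm_iteratedFDeriv_fderiv, fderiv_gaussian]
    have h := norm_iteratedFDeriv_smul_le (n := n) (contDiff_gaussian (E := E) b)
      (((-(2 * b)) • innerSL ℝ (E := E)).contDiff) x (mod_cast le_top)
    refine (mul_le_mul_of_nonneg_left h (by positivity)).trans ?_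
    rw [Finset.mul_sum]
    refine Finset.sum_le_sum fun i hi => ?_
    have h1 := hL (n - i) (Nat.sub_le _ _) x
    have h2 := hC i (Finset.mem_range.1 hi) k x
    have h3 := hC i (Finset.mem_range.1 hi) (k + l) x
    have h4 : (1 + ‖x‖) ^ l ≤ 2 ^ l * (1 + ‖x‖ ^ l) := by
      have h := add_pow_le zero_le_one (norm_nonneg x) l
      rw [one_pow] at h
      refine h.trans (mul_le_mul_of_nonneg_right ?_ (by positivity))
      exact pow_le_pow_right₀ one_le_two (Nat.sub_le _ _)
    set A := ‖iteratedFDeriv ℝ i (fun x : E => Real.exp (-(b * ‖x‖ ^ 2))) x‖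
    calc ‖x‖ ^ k * ((n.choose i : ℝ) * A * _)
        ≤ ‖x‖ ^ k * ((n.choose i : ℝ) * A * (D * (2 ^ l * (1 + ‖x‖ ^ l)))) := by
          gcongr
          exact h1.trans (by gcongr)
      _ = (n.choose i : ℝ) * (D * (2 ^ l * (‖x‖ ^ k * A + ‖x‖ ^ (k + l) * A))) := by ring
      _ ≤ _ := by gcongr

/-- The Gaussian `exp (-b |x|²)` as a complex-valued Schwartz function. -/
def gaussian (E : Type*) [NormedAddCommGroup E] [InnerProductSpace ℝ E] {b : ℝ} (hb : 0 < b) :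
    𝓢(E, ℂ) :=
  SchwartzMap.postcompCLM (𝕜 := ℝ) (F := ℝ) (G := ℂ) Complex.ofRealCLM
    { toFun := fun x => Real.exp (-(b * ‖x‖ ^ 2))
      smooth' := contDiff_gaussian b
      decay' := fun k n => gaussian_decay hb n k }

theorem gaussian_apply {b : ℝ} (hb : 0 < b) (x : E) :
    gaussian E hb x = ((Real.exp (-(b * ‖x‖ ^ 2)) : ℝ) : ℂ) := rfl

end Gaussian

/-! ### Profiles -/

section Profile
variable {E : Type*} [NormedAddCommGroup E] [InnerProductSpace ℝ E] [FiniteDimensional ℝ E]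
  [MeasurableSpace E] [BorelSpace E] {F : Type*} [NormedAddCommGroup F]

/-- The functions whose dilates are superposed to build convolution kernels: integrable, with a
finite moment of order `1/2` and a Lipschitz `L¹` modulus of continuity. -/
structure IsProfile (ψ : E → F) : Prop where
  stronglyMeasurable : StronglyMeasurable ψ
  lintegral_lt_top : ∫⁻ z, ‖ψ z‖ₑ < ∞
  moment_lt_top : ∫⁻ z, ‖z‖ₑ ^ (1 / 2 : ℝ) * ‖ψ z‖ₑ < ∞
  modulus : ∃ C : ℝ≥0, ∀ h : E, ∫⁻ z, ‖ψ (z - h) - ψ z‖ₑ ≤ C * ‖h‖ₑ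

theorem IsProfile.integrable {ψ : E → F} (hψ : IsProfile ψ) : Integrable ψ :=
  ⟨hψ.stronglyMeasurable.aestronglyMeasurable, hψ.lintegral_lt_top⟩

variable [NormedSpace ℂ F]

/-- A Schwartz function has a Lipschitz `L¹` modulus of continuity: the difference is the integral
of the derivative along a segment. -/
theorem lintegral_enorm_sub_translate_le [CompleteSpace F] (f : 𝓢(E, F)) (h : E) :
    ∫⁻ z, ‖f (z - h) - f z‖ₑ ≤ (∫⁻ z, ‖fderiv ℝ f z‖ₑ) * ‖h‖ₑ := by
  have hc : Continuous (fderiv ℝ f) := (f.smooth 1).continuous_fderiv one_ne_zero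
  have key : ∀ z, ‖f (z - h) - f z‖ₑ ≤
      ∫⁻ s in Set.Ioc (0 : ℝ) 1, ‖fderiv ℝ f (z - s • h)‖ₑ * ‖h‖ₑ := by
    intro z
    have hd : ∀ s : ℝ, HasDerivAt (fun s : ℝ => f (z - s • h)) (fderiv ℝ f (z - s • h) (-h)) s := by
      intro s
      have h1 : HasDerivAt (fun s : ℝ => z - s • h) (-h) s := by
        simpa using ((hasDerivAt_id s).smul_const h).const_sub z
      exact (f.differentiable (z - s • h)).hasFDerivAt.comp_hasDerivAt s h1
    have hint := intervalIntegral.integral_eq_sub_of_hasDerivAt (a := 0) (b := 1) (fun s _ => hd s)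
      (Continuous.intervalIntegrable (by fun_prop) _ _)
    simp only [one_smul, zero_smul, sub_zero] at hint
    rw [← hint, intervalIntegral.integral_of_le zero_le_one]
    refine (enorm_integral_le_lintegral_enorm _).trans (lintegral_mono fun s => ?_)
    have := (fderiv ℝ f (z - s • h)).le_opENorm (-h)
    rwa [enorm_neg] at this
  calc ∫⁻ z, ‖f (z - h) - f z‖ₑ
      ≤ ∫⁻ z, ∫⁻ s in Set.Ioc (0 : ℝ) 1, ‖fderiv ℝ f (z - s • h)‖ₑ * ‖h‖ₑ := lintegral_mono key
    _ = ∫⁻ s in Set.Ioc (0 : ℝ) 1, ∫⁻ z, ‖fderiv ℝ f (z - s • h)‖ₑ * ‖h‖ₑ := by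
      refine lintegral_lintegral_swap (Continuous.aemeasurable ?_)
      simp only [Function.uncurry_def]
      exact (ENNReal.continuous_mul_const (by simp)).comp
        (continuous_enorm.comp (hc.comp (by fun_prop)))
    _ = ∫⁻ _s in Set.Ioc (0 : ℝ) 1, (∫⁻ z, ‖fderiv ℝ f z‖ₑ) * ‖h‖ₑ := by
      refine lintegral_congr fun s => ?_
      rw [lintegral_mul_const' _ _ (by simp),
        lintegral_sub_right_eq_self (fun z => ‖fderiv ℝ f z‖ₑ) (s • h)]
    _ = _ := by simp

theorem isProfile_schwartzMap [CompleteSpace F] (f : 𝓢(E, F)) : IsProfile f where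
  stronglyMeasurable := f.continuous.stronglyMeasurable
  lintegral_lt_top := f.integrable.2
  moment_lt_top := by
    have h1 : Integrable (fun z => f z) := f.integrable
    have h2 := f.integrable_pow_mul volume 1
    refine lt_of_le_of_lt (lintegral_mono fun z => ?_) (h1.norm.add h2).2
    have hz : ‖z‖ ^ (1 / 2 : ℝ) ≤ 1 + ‖z‖ := by
      calc ‖z‖ ^ (1 / 2 : ℝ) ≤ (1 + ‖z‖) ^ (1 / 2 : ℝ) := by gcongr; linarith
        _ ≤ (1 + ‖z‖) ^ (1 : ℝ) :=
          Real.rpow_le_rpow_of_exponent_le (by linarith [norm_nonneg z]) (by norm_num)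
        _ = _ := Real.rpow_one _
    rw [← ofReal_norm, ← ofReal_norm, ENNReal.ofReal_rpow_of_nonneg (norm_nonneg _) (by norm_num),
      ← ENNReal.ofReal_mul (by positivity), ← ofReal_norm]
    refine ENNReal.ofReal_le_ofReal ?_
    simp only [Pi.add_apply, pow_one]
    rw [Real.norm_of_nonneg (by positivity)]
    nlinarith [norm_nonneg (f z)]
  modulus := by
    have h : ∫⁻ z, ‖fderiv ℝ f z‖ₑ < ∞ :=
      ((SchwartzMap.fderivCLM ℝ E F f).integrable (μ := volume)).2
    lift (∫⁻ z, ‖fderiv ℝ f z‖ₑ) to ℝ≥0 using h.ne with C hC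
    exact ⟨C, fun h => hC ▸ lintegral_enorm_sub_translate_le f h⟩

end Profile

/-! ### Dilates -/

section Dilate
variable {E : Type*} [NormedAddCommGroup E] [InnerProductSpace ℝ E] [FiniteDimensional ℝ E]
  [MeasurableSpace E] [BorelSpace E] {F : Type*} [NormedAddCommGroup F] [NormedSpace ℂ F]

/-- The `L¹`-normalised dilate of `ψ` to the length scale `σ`. -/
def dilate (σ : ℝ) (ψ : E → F) (z : E) : F := ((σ ^ Module.finrank ℝ E)⁻¹ : ℝ) • ψ (σ⁻¹ • z)

/-- Change of variables for the `L¹`-normalised dilation. -/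
theorem lintegral_comp_inv_smul (g : E → ℝ≥0∞) {σ : ℝ} (hσ : 0 < σ) :
    ∫⁻ z, ‖((σ ^ Module.finrank ℝ E)⁻¹ : ℝ)‖ₑ * g (σ⁻¹ • z) = ∫⁻ z, g z := by
  have he : MeasurableEmbedding fun z : E => σ⁻¹ • z :=
    (Homeomorph.smulOfNeZero σ⁻¹ (inv_ne_zero hσ.ne')).measurableEmbedding
  rw [lintegral_const_mul' _ _ (by simp), ← he.lintegral_map,
    Measure.map_addHaar_smul _ (inv_ne_zero hσ.ne'), lintegral_smul_measure, smul_eq_mul,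
    ← mul_assoc, Real.enorm_of_nonneg (by positivity), ← ENNReal.ofReal_mul (by positivity)]
  rw [abs_of_nonneg (by positivity), inv_pow, inv_inv, inv_mul_cancel₀ (by positivity)]
  simp

theorem lintegral_enorm_dilate (ψ : E → F) {σ : ℝ} (hσ : 0 < σ) :
    ∫⁻ z, ‖dilate σ ψ z‖ₑ = ∫⁻ z, ‖ψ z‖ₑ := by
  rw [← lintegral_comp_inv_smul (fun z => ‖ψ z‖ₑ) hσ]
  simp only [dilate, enorm_smul]

theorem lintegral_moment_dilate (ψ : E → F) {σ : ℝ} (hσ : 0 < σ) :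
    ∫⁻ z, ‖z‖ₑ ^ (1 / 2 : ℝ) * ‖dilate σ ψ z‖ₑ =
      ENNReal.ofReal σ ^ (1 / 2 : ℝ) * ∫⁻ z, ‖z‖ₑ ^ (1 / 2 : ℝ) * ‖ψ z‖ₑ := by
  rw [← lintegral_comp_inv_smul (fun z => ‖z‖ₑ ^ (1 / 2 : ℝ) * ‖ψ z‖ₑ) hσ,
    ← lintegral_const_mul' _ _ (by finiteness)]
  refine lintegral_congr fun z => ?_
  have hz : ‖z‖ₑ = ENNReal.ofReal σ * ‖σ⁻¹ • z‖ₑ := by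
    rw [← Real.enorm_of_nonneg hσ.le, ← enorm_smul, smul_smul, mul_inv_cancel₀ hσ.ne', one_smul]
  rw [dilate, enorm_smul, hz, ENNReal.mul_rpow_of_nonneg _ _ (by norm_num)]
  ring

theorem lintegral_modulus_dilate {ψ : E → F} {C : ℝ≥0}
    (hC : ∀ h : E, ∫⁻ z, ‖ψ (z - h) - ψ z‖ₑ ≤ C * ‖h‖ₑ) {σ : ℝ} (hσ : 0 < σ) (h : E) :
    ∫⁻ z, ‖dilate σ ψ (z - h) - dilate σ ψ z‖ₑ ≤ C * ‖h‖ₑ * ENNReal.ofReal σ⁻¹ := by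
  have := hC (σ⁻¹ • h)
  rw [← lintegral_comp_inv_smul (fun z => ‖ψ (z - σ⁻¹ • h) - ψ z‖ₑ) hσ, enorm_smul,
    Real.enorm_of_nonneg (inv_nonneg.2 hσ.le)] at this
  simp only [dilate, ← smul_sub, enorm_smul] at this ⊢
  exact this.trans_eq (by ring)

theorem fourier_dilate (ψ : E → F) {σ : ℝ} (hσ : 0 < σ) (ξ : E) :
    𝓕 (dilate σ ψ) ξ = 𝓕 ψ (σ • ξ) := by
  simp only [Real.fourier_eq, dilate]
  have := Measure.integral_comp_inv_smul_of_nonneg volume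
    (fun z : E => Real.fourierChar (-inner ℝ z (σ • ξ)) • ψ z) hσ.le
  have h2 : ∀ z : E,
      Real.fourierChar (-inner ℝ z ξ) • ((σ ^ Module.finrank ℝ E)⁻¹ : ℝ) • ψ (σ⁻¹ • z)
      = ((σ ^ Module.finrank ℝ E)⁻¹ : ℝ) •
        (Real.fourierChar (-inner ℝ (σ⁻¹ • z) (σ • ξ)) • ψ (σ⁻¹ • z)) := by
    intro z
    rw [inner_smul_left, inner_smul_right, smul_comm]
    simp [hσ.ne']
  simp_rw [h2]
  rw [integral_smul, this, smul_smul, inv_mul_cancel₀ (by positivity), one_smul]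

end Dilate

/-! ### Superpositions of dilates -/

section Superpose
variable {E : Type*} [NormedAddCommGroup E] [InnerProductSpace ℝ E] [FiniteDimensional ℝ E]
  [MeasurableSpace E] [BorelSpace E] {F : Type*} [NormedAddCommGroup F] [NormedSpace ℂ F]

/-- The superposition of the dilates of `ψ` to the scales `σ t`, weighted by the measure `ν`. -/
def superpose (ν : Measure ℝ) (σ : ℝ → ℝ) (ψ : E → F) (z : E) : F := ∫ t, dilate (σ t) ψ z ∂ν

variable {ν : Measure ℝ} {σ : ℝ → ℝ} {ψ : E → F}

theorem stronglyMeasurable_dilate (hψ : StronglyMeasurable ψ) (hσ : Measurable σ) :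
    StronglyMeasurable fun p : E × ℝ => dilate (σ p.2) ψ p.1 := by
  unfold dilate
  refine StronglyMeasurable.smul (f := fun p : E × ℝ => ((σ p.2 ^ Module.finrank ℝ E)⁻¹ : ℝ))
    (Measurable.stronglyMeasurable (by fun_prop)) ?_
  exact hψ.comp_measurable (by fun_prop)

theorem stronglyMeasurable_superpose [SFinite ν] (hψ : StronglyMeasurable ψ) (hσ : Measurable σ) :
    StronglyMeasurable (superpose ν σ ψ) :=
  (stronglyMeasurable_dilate hψ hσ).integral_prod_right

/-- Minkowski's integral inequality in `L¹(w)`. -/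
theorem lintegral_mul_enorm_integral_le [SFinite ν] {g : E → ℝ → F}
    (hg : StronglyMeasurable fun p : E × ℝ => g p.1 p.2) {w : E → ℝ≥0∞} (hw : Measurable w) :
    ∫⁻ z, w z * ‖∫ t, g z t ∂ν‖ₑ ≤ ∫⁻ t, (∫⁻ z, w z * ‖g z t‖ₑ) ∂ν := by
  rw [← lintegral_lintegral_swap]
  · refine lintegral_mono fun z => ?_
    have hz : Measurable fun t => ‖g z t‖ₑ :=
      (hg.comp_measurable (measurable_prodMk_left (x := z))).enorm
    simp only
    rw [lintegral_const_mul _ hz]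
    gcongr
    exact enorm_integral_le_lintegral_enorm _
  · exact ((hw.comp measurable_fst).mul hg.enorm).aemeasurable

theorem integrable_dilate_prod [IsFiniteMeasure ν] (hψ : StronglyMeasurable ψ)
    (hi : ∫⁻ z, ‖ψ z‖ₑ < ∞) (hσ : Measurable σ) (h0 : ∀ᵐ t ∂ν, 0 < σ t) :
    Integrable (fun p : E × ℝ => dilate (σ p.2) ψ p.1) (volume.prod ν) := by
  refine ⟨(stronglyMeasurable_dilate hψ hσ).aestronglyMeasurable, ?_⟩
  rw [HasFiniteIntegral, lintegral_prod_symm' _ (stronglyMeasurable_dilate hψ hσ).enorm]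
  have : ∀ᵐ t ∂ν, ∫⁻ z, ‖dilate (σ t) ψ z‖ₑ = ∫⁻ z, ‖ψ z‖ₑ := by
    filter_upwards [h0] with t ht using lintegral_enorm_dilate ψ ht
  rw [lintegral_congr_ae this, lintegral_const]
  exact ENNReal.mul_lt_top hi (measure_lt_top ν _)

theorem integrable_superpose [IsFiniteMeasure ν] (hψ : StronglyMeasurable ψ)
    (hi : ∫⁻ z, ‖ψ z‖ₑ < ∞) (hσ : Measurable σ) (h0 : ∀ᵐ t ∂ν, 0 < σ t) :
    Integrable (superpose ν σ ψ) :=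
  (integrable_dilate_prod hψ hi hσ h0).integral_prod_left

theorem lintegral_mul_enorm_superpose_le [SFinite ν] (hψ : StronglyMeasurable ψ)
    (hσ : Measurable σ) {w : E → ℝ≥0∞} (hw : Measurable w) :
    ∫⁻ z, w z * ‖superpose ν σ ψ z‖ₑ ≤ ∫⁻ t, (∫⁻ z, w z * ‖dilate (σ t) ψ z‖ₑ) ∂ν :=
  lintegral_mul_enorm_integral_le (stronglyMeasurable_dilate hψ hσ) hw

theorem lintegral_mul_enorm_superpose_sub_le [IsFiniteMeasure ν] (hψ : StronglyMeasurable ψ)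
    (hi : ∫⁻ z, ‖ψ z‖ₑ < ∞) (hσ : Measurable σ) (h0 : ∀ᵐ t ∂ν, 0 < σ t)
    {w : E → ℝ≥0∞} (hw : Measurable w) (h : E) :
    ∫⁻ z, w z * ‖superpose ν σ ψ (z - h) - superpose ν σ ψ z‖ₑ ≤
      ∫⁻ t, (∫⁻ z, w z * ‖dilate (σ t) ψ (z - h) - dilate (σ t) ψ z‖ₑ) ∂ν := by
  have hm := stronglyMeasurable_dilate hψ hσ
  -- The integral defining `superpose` is additive only where it converges, which is almost
  -- everywhere by Fubini.
  have h1 : ∀ᵐ z, Integrable (fun t => dilate (σ t) ψ z) ν :=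
    (integrable_dilate_prod hψ hi hσ h0).prod_right_ae
  have h2 : ∀ᵐ z, Integrable (fun t => dilate (σ t) ψ (z - h)) ν :=
    (measurePreserving_sub_right volume h).quasiMeasurePreserving.ae h1
  refine le_trans (le_of_eq (lintegral_congr_ae ?_)) (lintegral_mul_enorm_integral_le
    (g := fun z t => dilate (σ t) ψ (z - h) - dilate (σ t) ψ z) ?_ hw)
  · filter_upwards [h1, h2] with z hz1 hz2
    rw [superpose, superpose, integral_sub hz2 hz1]
  · exact (hm.comp_measurable (g := fun p : E × ℝ => (p.1 - h, p.2)) (by fun_prop)).sub hm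

theorem fourier_superpose [IsFiniteMeasure ν] (hψ : StronglyMeasurable ψ)
    (hi : ∫⁻ z, ‖ψ z‖ₑ < ∞) (hσ : Measurable σ) (h0 : ∀ᵐ t ∂ν, 0 < σ t) (ξ : E) :
    𝓕 (superpose ν σ ψ) ξ = ∫ t, 𝓕 ψ (σ t • ξ) ∂ν := by
  have hint := integrable_dilate_prod hψ hi hσ h0
  rw [Real.fourier_eq]
  calc ∫ z, Real.fourierChar (-inner ℝ z ξ) • superpose ν σ ψ z
      = ∫ z, (∫ t, Real.fourierChar (-inner ℝ z ξ) • dilate (σ t) ψ z ∂ν) := by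
        refine integral_congr_ae (Filter.Eventually.of_forall fun z => ?_)
        simp only [superpose, Circle.smul_def, integral_smul]
    _ = ∫ t, (∫ z, Real.fourierChar (-inner ℝ z ξ) • dilate (σ t) ψ z) ∂ν := by
        refine integral_integral_swap (hint.mono ?_ (Filter.Eventually.of_forall fun p => ?_))
        · exact (Continuous.aestronglyMeasurable (by fun_prop)).smul hint.aestronglyMeasurable
        · rw [Function.uncurry, Circle.norm_smul]
    _ = ∫ t, 𝓕 ψ (σ t • ξ) ∂ν := by
        refine integral_congr_ae ?_
        filter_upwards [h0] with t ht
        rw [← fourier_dilate ψ ht ξ, Real.fourier_eq]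

/-- A superposition of dilates of a profile is a profile if the scales have finite moments of
orders `1/2` and `-1` with respect to `ν`. -/
theorem isProfile_superpose [IsFiniteMeasure ν] (hψ : IsProfile ψ) (hσ : Measurable σ)
    (h0 : ∀ᵐ t ∂ν, 0 < σ t) (h1 : ∫⁻ t, ENNReal.ofReal (σ t) ^ (1 / 2 : ℝ) ∂ν < ∞)
    (h2 : ∫⁻ t, ENNReal.ofReal (σ t)⁻¹ ∂ν < ∞) : IsProfile (superpose ν σ ψ) where
  stronglyMeasurable := stronglyMeasurable_superpose hψ.stronglyMeasurable hσ
  lintegral_lt_top :=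
    (integrable_superpose hψ.stronglyMeasurable hψ.lintegral_lt_top hσ h0).2
  moment_lt_top := by
    refine (lintegral_mul_enorm_superpose_le hψ.stronglyMeasurable hσ (by fun_prop)).trans_lt ?_
    have : ∀ᵐ t ∂ν, _ := h0.mono fun t ht => lintegral_moment_dilate ψ ht
    rw [lintegral_congr_ae this, lintegral_mul_const' _ _ hψ.moment_lt_top.ne]
    exact ENNReal.mul_lt_top h1 hψ.moment_lt_top
  modulus := by
    obtain ⟨C, hC⟩ := hψ.modulus
    lift (∫⁻ t, ENNReal.ofReal (σ t)⁻¹ ∂ν) to ℝ≥0 using h2.ne with D hD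
    refine ⟨C * D, fun h => ?_⟩
    have := lintegral_mul_enorm_superpose_sub_le hψ.stronglyMeasurable hψ.lintegral_lt_top hσ h0
      (measurable_const (a := (1 : ℝ≥0∞))) h
    simp only [one_mul] at this
    refine this.trans ((lintegral_mono_ae (h0.mono fun t ht =>
      lintegral_modulus_dilate hC ht h)).trans_eq ?_)
    rw [lintegral_const_mul' _ _ (by finiteness), ← hD, ENNReal.coe_mul]
    ring

end Superpose

/-! ### The measure on the scales -/

section ScaleMeasure

/-- The density `(2/√π) exp (-t²) / t` with which the profiles of scale `t` are superposed. -/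
def scaleDensity (t : ℝ) : ℝ := 2 / √Real.pi * Real.exp (-t ^ 2) / t

/-- The measure with density `scaleDensity` on the scales larger than `ε`; it is finite when
`0 < ε`. -/
def scaleMeasure (ε : ℝ) : Measure ℝ :=
  (volume.restrict (Set.Ioi ε)).withDensity fun t => ENNReal.ofReal (scaleDensity t)

theorem measurable_scaleDensity : Measurable scaleDensity := by
  unfold scaleDensity; fun_prop

theorem two_div_sqrt_pi_le : 2 / √Real.pi ≤ 2 := by
  have : 1 ≤ √Real.pi := Real.one_le_sqrt.2 (by linarith [Real.pi_gt_three])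
  exact div_le_self (by norm_num) this

theorem scaleDensity_le {t : ℝ} (ht : 0 < t) : scaleDensity t ≤ 2 * t⁻¹ := by
  rw [scaleDensity, div_eq_mul_inv]
  gcongr
  calc 2 / √Real.pi * Real.exp (-t ^ 2) ≤ 2 * 1 := by
        gcongr
        · exact two_div_sqrt_pi_le
        · exact Real.exp_le_one_iff.2 (by nlinarith [sq_nonneg t])
    _ = 2 := by norm_num

theorem scaleDensity_nonneg {t : ℝ} (ht : 0 < t) : 0 ≤ scaleDensity t := by
  unfold scaleDensity; positivity

theorem lintegral_scaleMeasure {ε : ℝ} {g : ℝ → ℝ≥0∞} (hg : Measurable g) :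
    ∫⁻ t, g t ∂(scaleMeasure ε) = ∫⁻ t in Set.Ioi ε, ENNReal.ofReal (scaleDensity t) * g t := by
  rw [scaleMeasure, lintegral_withDensity_eq_lintegral_mul _
    measurable_scaleDensity.ennreal_ofReal hg]
  rfl

theorem scaleMeasure_mono {ε : ℝ} (hε : 0 < ε) : scaleMeasure ε ≤ scaleMeasure 0 := by
  refine Measure.le_iff.2 fun s hs => ?_
  rw [scaleMeasure, scaleMeasure, withDensity_apply _ hs, withDensity_apply _ hs]
  exact lintegral_mono' (Measure.restrict_mono le_rfl
    (Measure.restrict_mono (Set.Ioi_subset_Ioi hε.le) le_rfl)) le_rfl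

theorem ae_scaleMeasure_pos {ε : ℝ} (hε : 0 ≤ ε) : ∀ᵐ t ∂(scaleMeasure ε), 0 < t := by
  refine (withDensity_absolutelyContinuous _ _).ae_le ?_
  filter_upwards [ae_restrict_mem measurableSet_Ioi] with t ht using hε.trans_lt ht

theorem lintegral_scaleDensity_lt_top {ε : ℝ} (hε : 0 < ε) :
    ∫⁻ t in Set.Ioi ε, ENNReal.ofReal (scaleDensity t) < ∞ := by
  have hi := (integrable_exp_neg_mul_sq one_pos).const_mul (2 / ε)
  refine lt_of_le_of_lt ((setLIntegral_mono' measurableSet_Ioi fun t ht => ?_).trans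
    (setLIntegral_le_lintegral _ _)) hi.2
  rw [← ofReal_norm]
  refine ENNReal.ofReal_le_ofReal ((le_trans ?_ (le_abs_self _)))
  have ht' : ε < t := ht
  have ht0 : 0 < t := hε.trans ht'
  rw [scaleDensity, mul_div_right_comm, ← neg_one_mul (t ^ 2)]
  change _ ≤ 2 / ε * Real.exp (-1 * t ^ 2)
  gcongr
  exact two_div_sqrt_pi_le

theorem isFiniteMeasure_scaleMeasure {ε : ℝ} (hε : 0 < ε) : IsFiniteMeasure (scaleMeasure ε) :=
  ⟨by
    have h := lintegral_scaleMeasure (ε := ε) (measurable_const (a := (1 : ℝ≥0∞)))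
    simp only [lintegral_one, mul_one] at h
    rw [h]
    exact lintegral_scaleDensity_lt_top hε⟩

/-- The small scales, against the bound `√t` that comes from the moment of order `1/2`. -/
theorem lintegral_Ioc_scaleDensity_le {r : ℝ} (hr : 0 < r) :
    ∫⁻ t in Set.Ioc 0 r, ENNReal.ofReal (scaleDensity t) * ENNReal.ofReal (t ^ (1 / 2 : ℝ)) ≤
      ENNReal.ofReal (4 * r ^ (1 / 2 : ℝ)) := by
  have hi : IntegrableOn (fun t : ℝ => 2 * t ^ (-(1 / 2) : ℝ)) (Set.Ioc 0 r) := by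
    refine Integrable.const_mul ?_ _
    exact (intervalIntegrable_iff_integrableOn_Ioc_of_le hr.le).1
      (intervalIntegral.intervalIntegrable_rpow' (by norm_num))
  have hv : ∫ t in Set.Ioc 0 r, 2 * t ^ (-(1 / 2) : ℝ) = 4 * r ^ (1 / 2 : ℝ) := by
    rw [integral_const_mul, ← intervalIntegral.integral_of_le hr.le,
      integral_rpow (Or.inl (by norm_num))]
    norm_num
    ring
  rw [← hv, ofReal_integral_eq_lintegral_ofReal hi]
  · refine setLIntegral_mono' measurableSet_Ioc fun t ht => ?_
    have ht0 : 0 < t := ht.1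
    rw [← ENNReal.ofReal_mul (scaleDensity_nonneg ht0)]
    refine ENNReal.ofReal_le_ofReal ?_
    calc scaleDensity t * t ^ (1 / 2 : ℝ) ≤ 2 * t⁻¹ * t ^ (1 / 2 : ℝ) := by
          gcongr; exact scaleDensity_le ht0
      _ = 2 * t ^ (-(1 / 2) : ℝ) := by
          rw [mul_assoc, ← Real.rpow_neg_one, ← Real.rpow_add ht0]; norm_num
  · filter_upwards [ae_restrict_mem measurableSet_Ioc] with t ht
    have := ht.1
    simp only [Pi.zero_apply]
    positivity

/-- The large scales, against the bound `1/t` that comes from the `L¹` modulus of continuity. -/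
theorem lintegral_Ioi_scaleDensity_le {r : ℝ} (hr : 0 < r) :
    ∫⁻ t in Set.Ioi r, ENNReal.ofReal (scaleDensity t) * ENNReal.ofReal t⁻¹ ≤
      ENNReal.ofReal (2 * r⁻¹) := by
  have hi : IntegrableOn (fun t : ℝ => 2 * t ^ (-2 : ℝ)) (Set.Ioi r) :=
    (integrableOn_Ioi_rpow_of_lt (by norm_num) hr).const_mul _
  have hv : ∫ t in Set.Ioi r, 2 * t ^ (-2 : ℝ) = 2 * r⁻¹ := by
    rw [integral_const_mul, integral_Ioi_rpow_of_lt (by norm_num) hr]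
    norm_num
    rw [Real.rpow_neg_one]
  rw [← hv, ofReal_integral_eq_lintegral_ofReal hi]
  · refine setLIntegral_mono' measurableSet_Ioi fun t ht => ?_
    have ht0 : 0 < t := hr.trans ht
    rw [← ENNReal.ofReal_mul (scaleDensity_nonneg ht0)]
    refine ENNReal.ofReal_le_ofReal ?_
    calc scaleDensity t * t⁻¹ ≤ 2 * t⁻¹ * t⁻¹ := by
          gcongr; exact scaleDensity_le ht0
      _ = 2 * t ^ (-2 : ℝ) := by
          rw [mul_assoc, ← Real.rpow_neg_one, ← Real.rpow_add ht0]; norm_num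
  · filter_upwards [ae_restrict_mem measurableSet_Ioi] with t ht
    have : 0 < t := hr.trans ht
    simp only [Pi.zero_apply]
    positivity

/-- Splitting the integral over the scales at `r`: a function bounded by `A √t` for `t ≤ r` and by
`B t` for `t > r` has an integral bounded independently of the truncation `ε`. -/
theorem lintegral_scaleMeasure_le {ε : ℝ} (hε : 0 < ε) {r : ℝ} (hr : 0 < r)
    {G : ℝ → ℝ≥0∞} {A : ℝ≥0∞} {B : ℝ → ℝ≥0∞} (hG : Measurable G)
    (h1 : ∀ t, 0 < t → t ≤ r → G t ≤ A * ENNReal.ofReal (t ^ (1 / 2 : ℝ)))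
    (h2 : ∀ t, r < t → G t ≤ B t) :
    ∫⁻ t, G t ∂(scaleMeasure ε) ≤ A * ENNReal.ofReal (4 * r ^ (1 / 2 : ℝ)) +
      ∫⁻ t in Set.Ioi r, ENNReal.ofReal (scaleDensity t) * B t := by
  refine (lintegral_mono' (scaleMeasure_mono hε) le_rfl).trans ?_
  rw [lintegral_scaleMeasure hG, ← Set.Ioc_union_Ioi_eq_Ioi hr.le,
    lintegral_union measurableSet_Ioi (Set.Ioc_disjoint_Ioi le_rfl)]
  refine add_le_add ?_ (setLIntegral_mono' measurableSet_Ioi fun t ht => by gcongr; exact h2 t ht)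
  have hm : Measurable fun t =>
      ENNReal.ofReal (scaleDensity t) * ENNReal.ofReal (t ^ (1 / 2 : ℝ)) := by
    have := measurable_scaleDensity
    fun_prop
  calc _ ≤ ∫⁻ t in Set.Ioc 0 r, A * (ENNReal.ofReal (scaleDensity t) *
          ENNReal.ofReal (t ^ (1 / 2 : ℝ))) := by
        refine setLIntegral_mono' measurableSet_Ioc fun t ht => ?_
        rw [mul_left_comm]
        gcongr
        exact h1 t ht.1 ht.2
    _ = _ := lintegral_const_mul _ hm
    _ ≤ _ := by gcongr; exact lintegral_Ioc_scaleDensity_le hr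

end ScaleMeasure

/-! ### Uniform kernel estimates -/

section Kernel
variable {E : Type*} [NormedAddCommGroup E] [InnerProductSpace ℝ E] [FiniteDimensional ℝ E]
  [MeasurableSpace E] [BorelSpace E] {F : Type*} [NormedAddCommGroup F] [NormedSpace ℂ F]

/-- The conditions on a convolution kernel under which it maps atoms into functions that are
integrable away from the support of the atom: Hörmander's condition at scales at most one, and
integrability at infinity. The integrability of the kernel itself enters only qualitatively: its
`L¹` norm need not be bounded by `C`. -/
structure IsAtomKernel (K : E → F) (C : ℝ≥0) : Prop where
  stronglyMeasurable : StronglyMeasurable K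
  integrable : Integrable K
  hormander : ∀ r : ℝ, 0 < r → r ≤ 1 → ∀ h : E, ‖h‖ < r →
    ∫⁻ z in {z | 2 * r ≤ ‖z‖}, ‖K (z - h) - K z‖ₑ ≤ C
  tail : ∫⁻ z in {z | 1 ≤ ‖z‖}, ‖K z‖ₑ ≤ C

/-- The superposition of the dilates of `ψ` to the scales larger than `ε`. -/
def truncKernel (ψ : E → F) (ε : ℝ) : E → F := superpose (scaleMeasure ε) id ψ

/-- Chebyshev's inequality for the moment of order `1/2`. -/
theorem setLIntegral_norm_ge_dilate_le (ψ : E → F) {t r : ℝ} (ht : 0 < t) (hr : 0 < r) :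
    ∫⁻ z in {z | r ≤ ‖z‖}, ‖dilate t ψ z‖ₑ ≤
      ENNReal.ofReal (r ^ (-(1 / 2) : ℝ)) * (∫⁻ z, ‖z‖ₑ ^ (1 / 2 : ℝ) * ‖ψ z‖ₑ) *
        ENNReal.ofReal (t ^ (1 / 2 : ℝ)) := by
  have hm : MeasurableSet {z : E | r ≤ ‖z‖} := measurableSet_le measurable_const measurable_norm
  have hmom := lintegral_moment_dilate ψ ht
  rw [ENNReal.ofReal_rpow_of_nonneg ht.le (by norm_num)] at hmom
  rw [mul_assoc, mul_comm (lintegral _ _), ← hmom, ← lintegral_const_mul' _ _ (by simp)]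
  refine (setLIntegral_mono' hm fun z hz => ?_).trans (setLIntegral_le_lintegral _ _)
  rw [← mul_assoc]
  refine le_mul_of_one_le_left' ?_
  rw [← ofReal_norm, ENNReal.ofReal_rpow_of_nonneg (norm_nonneg _) (by norm_num),
    ← ENNReal.ofReal_mul (by positivity), ENNReal.one_le_ofReal, Real.rpow_neg hr.le]
  rw [inv_mul_eq_div, one_le_div (by positivity)]
  exact Real.rpow_le_rpow hr.le hz (by norm_num)

/-- The translation `h` is too short to bring `{2 r ≤ ‖z‖}` within distance `r` of the origin, so
both terms of the difference are bounded by the tail of the dilate. -/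
theorem setLIntegral_sub_dilate_le {ψ : E → F} (hψ : StronglyMeasurable ψ) {t r : ℝ}
    (ht : 0 < t) (hr : 0 < r) {h : E} (hh : ‖h‖ < r) :
    ∫⁻ z in {z | 2 * r ≤ ‖z‖}, ‖dilate t ψ (z - h) - dilate t ψ z‖ₑ ≤
      2 * ENNReal.ofReal (r ^ (-(1 / 2) : ℝ)) * (∫⁻ z, ‖z‖ₑ ^ (1 / 2 : ℝ) * ‖ψ z‖ₑ) *
        ENNReal.ofReal (t ^ (1 / 2 : ℝ)) := by
  have hm : ∀ s : ℝ, MeasurableSet {z : E | s ≤ ‖z‖} := fun s =>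
    measurableSet_le measurable_const measurable_norm
  have hd : StronglyMeasurable (dilate t ψ) := (hψ.comp_measurable (by fun_prop)).const_smul _
  have h1 : ∫⁻ z in {z | 2 * r ≤ ‖z‖}, ‖dilate t ψ (z - h)‖ₑ ≤
      ∫⁻ z in {z | r ≤ ‖z‖}, ‖dilate t ψ z‖ₑ := by
    rw [← lintegral_indicator (hm _), ← lintegral_indicator (hm _),
      ← lintegral_sub_right_eq_self (Set.indicator {z | r ≤ ‖z‖} fun z => ‖dilate t ψ z‖ₑ) h]
    refine lintegral_mono fun z => ?_
    by_cases hz : z ∈ {z : E | 2 * r ≤ ‖z‖}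
    · have hz' : r ≤ ‖z - h‖ := by
        have : 2 * r ≤ ‖z‖ := hz
        linarith [norm_sub_norm_le z h]
      rw [Set.indicator_of_mem hz, Set.indicator_of_mem (show z - h ∈ {z : E | r ≤ ‖z‖} from hz')]
    · rw [Set.indicator_of_notMem hz]; exact zero_le
  have h2 : ∫⁻ z in {z | 2 * r ≤ ‖z‖}, ‖dilate t ψ z‖ₑ ≤
      ∫⁻ z in {z | r ≤ ‖z‖}, ‖dilate t ψ z‖ₑ :=
    lintegral_mono_set fun z (hz : 2 * r ≤ ‖z‖) => show r ≤ ‖z‖ by linarith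
  calc _ ≤ ∫⁻ z in {z | 2 * r ≤ ‖z‖}, (‖dilate t ψ (z - h)‖ₑ + ‖dilate t ψ z‖ₑ) :=
        lintegral_mono fun z => enorm_sub_le
    _ = _ := lintegral_add_right _ hd.enorm
    _ ≤ _ := add_le_add (h1.trans (setLIntegral_norm_ge_dilate_le ψ ht hr))
        (h2.trans (setLIntegral_norm_ge_dilate_le ψ ht hr))
    _ = _ := by ring

theorem setLIntegral_eq_indicator_one_mul {s : Set E} (hs : MeasurableSet s) (f : E → ℝ≥0∞) :
    ∫⁻ z in s, f z = ∫⁻ z, s.indicator 1 z * f z := by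
  rw [← lintegral_indicator hs]
  refine lintegral_congr fun z => ?_
  by_cases hz : z ∈ s <;> simp [hz]

/-- The truncated kernels satisfy the Hörmander and tail conditions uniformly in the truncation. At
scales `t ≤ r` the tail of `ψ_t` contributes `(t/r)^{1/2}`, at scales `t > r` the modulus of
continuity contributes `r/t`, and both are integrable against `dt/t` with a bound independent of
`r`. -/
theorem IsProfile.exists_isAtomKernel {ψ : E → F} (hψ : IsProfile ψ) :
    ∃ C : ℝ≥0, ∀ ε : ℝ, 0 < ε → IsAtomKernel (truncKernel ψ ε) C := by
  obtain ⟨L, hL⟩ := hψ.modulus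
  have hM := hψ.moment_lt_top
  have hI := hψ.lintegral_lt_top
  set M := ∫⁻ z, ‖z‖ₑ ^ (1 / 2 : ℝ) * ‖ψ z‖ₑ with hMdef
  set I := ∫⁻ z, ‖ψ z‖ₑ with hIdef
  have hm : ∀ s : ℝ, MeasurableSet {z : E | s ≤ ‖z‖} := fun s =>
    measurableSet_le measurable_const measurable_norm
  -- `C1` bounds the Hörmander integrals and `C2` the tails.
  set C1 : ℝ≥0∞ := 8 * M + 2 * L
  set C2 : ℝ≥0∞ := 4 * M + (∫⁻ t in Set.Ioi 1, ENNReal.ofReal (scaleDensity t)) * I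
  have hC1 : C1 < ∞ := by finiteness
  have hC2 : C2 < ∞ := by
    have := lintegral_scaleDensity_lt_top one_pos
    finiteness
  have hsd := stronglyMeasurable_dilate hψ.stronglyMeasurable measurable_id
  refine ⟨(C1 + C2).toNNReal, fun ε hε => ?_⟩
  have := isFiniteMeasure_scaleMeasure hε
  have h0 : ∀ᵐ t ∂(scaleMeasure ε), 0 < id t := ae_scaleMeasure_pos hε.le
  refine ⟨stronglyMeasurable_superpose hψ.stronglyMeasurable measurable_id,
    integrable_superpose hψ.stronglyMeasurable hψ.lintegral_lt_top measurable_id h0, ?_, ?_⟩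
  · intro r hr hr1 h hh
    rw [ENNReal.coe_toNNReal (ENNReal.add_lt_top.2 ⟨hC1, hC2⟩).ne]
    refine le_trans ?_ le_self_add
    rw [setLIntegral_eq_indicator_one_mul (hm _)]
    refine (lintegral_mul_enorm_superpose_sub_le hψ.stronglyMeasurable hψ.lintegral_lt_top
      measurable_id h0 (measurable_one.indicator (hm _)) h).trans ?_
    refine (lintegral_scaleMeasure_le hε hr
      (A := 2 * ENNReal.ofReal (r ^ (-(1 / 2) : ℝ)) * M)
      (B := fun t => L * ENNReal.ofReal r * ENNReal.ofReal t⁻¹) ?_ ?_ ?_).trans ?_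
    · have h1 : Measurable fun p : ℝ × E => Set.indicator {z : E | 2 * r ≤ ‖z‖} (1 : E → ℝ≥0∞) p.2 *
          ‖dilate (id p.1) ψ (p.2 - h) - dilate (id p.1) ψ p.2‖ₑ := by
        refine ((measurable_one.indicator (hm _)).comp measurable_snd).mul ?_
        exact ((hsd.comp_measurable (g := fun p : ℝ × E => (p.2 - h, p.1)) (by fun_prop)).sub
          (hsd.comp_measurable (g := fun p : ℝ × E => (p.2, p.1)) (by fun_prop))).enorm
      exact h1.lintegral_prod_right'
    · intro t ht htr
      rw [← setLIntegral_eq_indicator_one_mul (hm _)]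
      exact setLIntegral_sub_dilate_le hψ.stronglyMeasurable ht hr hh
    · intro t ht
      rw [← setLIntegral_eq_indicator_one_mul (hm _)]
      refine (setLIntegral_le_lintegral _ _).trans
        ((lintegral_modulus_dilate hL (hr.trans ht) h).trans ?_)
      gcongr
      rw [← ofReal_norm]
      exact ENNReal.ofReal_le_ofReal hh.le
    · have e1 : ENNReal.ofReal (r ^ (-(1 / 2) : ℝ)) * ENNReal.ofReal (4 * r ^ (1 / 2 : ℝ)) = 4 := by
        rw [← ENNReal.ofReal_mul (by positivity), mul_left_comm, ← Real.rpow_add hr]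
        norm_num
      have e2 : ENNReal.ofReal r * ENNReal.ofReal (2 * r⁻¹) = 2 := by
        rw [← ENNReal.ofReal_mul hr.le, mul_left_comm, mul_inv_cancel₀ hr.ne']
        norm_num
      refine add_le_add (le_of_eq ?_) ?_
      · calc _ = 2 * M * (ENNReal.ofReal (r ^ (-(1 / 2) : ℝ)) *
              ENNReal.ofReal (4 * r ^ (1 / 2 : ℝ))) := by ring
          _ = 8 * M := by rw [e1]; ring
      · calc _ = ∫⁻ t in Set.Ioi r, L * ENNReal.ofReal r *
              (ENNReal.ofReal (scaleDensity t) * ENNReal.ofReal t⁻¹) := by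
              refine lintegral_congr fun t => by ring
          _ = L * ENNReal.ofReal r * _ := lintegral_const_mul' _ _ (by finiteness)
          _ ≤ L * ENNReal.ofReal r * ENNReal.ofReal (2 * r⁻¹) :=
              mul_le_mul_right (lintegral_Ioi_scaleDensity_le hr) _
          _ = 2 * L := by rw [mul_assoc, e2]; ring
  · rw [ENNReal.coe_toNNReal (ENNReal.add_lt_top.2 ⟨hC1, hC2⟩).ne]
    refine le_trans ?_ le_add_self
    rw [setLIntegral_eq_indicator_one_mul (hm _)]
    refine (lintegral_mul_enorm_superpose_le hψ.stronglyMeasurable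
      measurable_id (measurable_one.indicator (hm _))).trans ?_
    refine (lintegral_scaleMeasure_le hε one_pos (A := M) (B := fun t => I) ?_ ?_ ?_).trans ?_
    · have h1 : Measurable fun p : ℝ × E => Set.indicator {z : E | 1 ≤ ‖z‖} (1 : E → ℝ≥0∞) p.2 *
          ‖dilate (id p.1) ψ p.2‖ₑ := by
        refine ((measurable_one.indicator (hm _)).comp measurable_snd).mul ?_
        exact (hsd.comp_measurable (g := fun p : ℝ × E => (p.2, p.1)) (by fun_prop)).enorm
      exact h1.lintegral_prod_right'
    · intro t ht htr
      rw [← setLIntegral_eq_indicator_one_mul (hm _)]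
      simpa [hMdef] using setLIntegral_norm_ge_dilate_le ψ ht one_pos
    · intro t ht
      rw [← setLIntegral_eq_indicator_one_mul (hm _)]
      exact (setLIntegral_le_lintegral _ _).trans_eq (lintegral_enorm_dilate ψ (one_pos.trans ht))
    · rw [lintegral_mul_const' _ _ (by finiteness)]
      simp only [Real.one_rpow, mul_one, C2, ENNReal.ofReal_ofNat]
      rw [mul_comm M]

end Kernel

/-! ### Convolution with an atom away from its support -/

section AwayFromSupport
open scoped Convolution
variable {E : Type*} [NormedAddCommGroup E] [InnerProductSpace ℝ E] [FiniteDimensional ℝ E]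
  [MeasurableSpace E] [BorelSpace E] {F : Type*} [NormedAddCommGroup F] [NormedSpace ℂ F]

theorem setLIntegral_sub_right (g : E → ℝ≥0∞) (c : E) (s : ℝ) :
    ∫⁻ x in {x | s ≤ ‖x - c‖}, g (x - c) = ∫⁻ z in {z | s ≤ ‖z‖}, g z := by
  have hm : ∀ c : E, MeasurableSet {z : E | s ≤ ‖z - c‖} := fun c =>
    measurableSet_le measurable_const (by fun_prop)
  have hm0 : MeasurableSet {z : E | s ≤ ‖z‖} := measurableSet_le measurable_const (by fun_prop)
  rw [← lintegral_indicator (hm c), ← lintegral_indicator hm0,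
    ← lintegral_sub_right_eq_self (Set.indicator {z | s ≤ ‖z‖} g) c]
  rfl

/-- For a function with vanishing integral, the value `K (x - c)` may be subtracted from the kernel,
and Hörmander's condition applies. -/
theorem IsAtomKernel.lintegral_convolution_le_of_integral_eq_zero [CompleteSpace F]
    {K : E → F} {C : ℝ≥0} (hK : IsAtomKernel K C)
    {a : E → ℂ} (ha : StronglyMeasurable a) (hai : Integrable a) {c : E} {r : ℝ} (hr : 0 < r)
    (hr1 : r ≤ 1) (hsupp : ∀ᵐ x, x ∉ Metric.ball c r → a x = 0) (h0 : ∫ x, a x = 0) :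
    ∫⁻ x in {x | 2 * r ≤ ‖x - c‖}, ‖(a ⋆[ContinuousLinearMap.lsmul ℂ ℂ] K) x‖ₑ ≤
      C * ∫⁻ x, ‖a x‖ₑ := by
  have hKm := hK.stronglyMeasurable
  have hrep : ∀ᵐ x, (a ⋆[ContinuousLinearMap.lsmul ℂ ℂ] K) x =
      ∫ y, a y • (K (x - y) - K (x - c)) := by
    filter_upwards [hai.ae_convolution_exists (ContinuousLinearMap.lsmul ℂ ℂ) hK.integrable]
      with x hx
    have hx' : Integrable (fun y => a y • K (x - y)) := hx
    simp only [smul_sub]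
    rw [integral_sub hx' (hai.smul_const _), integral_smul_const, h0, zero_smul, sub_zero]
    rfl
  calc ∫⁻ x in {x | 2 * r ≤ ‖x - c‖}, ‖(a ⋆[ContinuousLinearMap.lsmul ℂ ℂ] K) x‖ₑ
      ≤ ∫⁻ x in {x | 2 * r ≤ ‖x - c‖}, ∫⁻ y, ‖a y‖ₑ * ‖K (x - y) - K (x - c)‖ₑ := by
        refine lintegral_mono_ae ((ae_restrict_of_ae hrep).mono fun x hx => ?_)
        rw [hx]
        refine (enorm_integral_le_lintegral_enorm _).trans_eq ?_
        simp only [enorm_smul]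
    _ = ∫⁻ y, ∫⁻ x in {x | 2 * r ≤ ‖x - c‖}, ‖a y‖ₑ * ‖K (x - y) - K (x - c)‖ₑ := by
        refine lintegral_lintegral_swap (Measurable.aemeasurable ?_)
        refine (ha.enorm.comp measurable_snd).mul (StronglyMeasurable.enorm ?_)
        exact (hKm.comp_measurable (by fun_prop)).sub (hKm.comp_measurable (by fun_prop))
    _ ≤ ∫⁻ y, C * ‖a y‖ₑ := by
        refine lintegral_mono_ae (hsupp.mono fun y hy => ?_)
        by_cases hyb : y ∈ Metric.ball c r
        · rw [lintegral_const_mul' _ _ (by simp), mul_comm]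
          gcongr
          have h := hK.hormander r hr hr1 (y - c) (by rwa [mem_ball_iff_norm] at hyb)
          rw [← setLIntegral_sub_right _ c] at h
          simpa using h
        · simp [hy hyb]
    _ = _ := lintegral_const_mul' _ _ (by simp)

/-- For a function supported in a ball of radius one, without cancellation, the integrability of the
kernel at infinity is enough. -/
theorem IsAtomKernel.lintegral_convolution_le {K : E → F} {C : ℝ≥0} (hK : IsAtomKernel K C)
    {a : E → ℂ} (ha : StronglyMeasurable a) {c : E}
    (hsupp : ∀ᵐ x, x ∉ Metric.ball c 1 → a x = 0) :
    ∫⁻ x in {x | 2 * 1 ≤ ‖x - c‖}, ‖(a ⋆[ContinuousLinearMap.lsmul ℂ ℂ] K) x‖ₑ ≤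
      C * ∫⁻ x, ‖a x‖ₑ := by
  have hKm := hK.stronglyMeasurable
  calc ∫⁻ x in {x | 2 * 1 ≤ ‖x - c‖}, ‖(a ⋆[ContinuousLinearMap.lsmul ℂ ℂ] K) x‖ₑ
      ≤ ∫⁻ x in {x | 2 * 1 ≤ ‖x - c‖}, ∫⁻ y, ‖a y‖ₑ * ‖K (x - y)‖ₑ := by
        refine lintegral_mono fun x => ?_
        refine (enorm_integral_le_lintegral_enorm _).trans_eq ?_
        simp only [ContinuousLinearMap.lsmul_apply, enorm_smul]
    _ = ∫⁻ y, ∫⁻ x in {x | 2 * 1 ≤ ‖x - c‖}, ‖a y‖ₑ * ‖K (x - y)‖ₑ := by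
        refine lintegral_lintegral_swap (Measurable.aemeasurable ?_)
        exact (ha.enorm.comp measurable_snd).mul (hKm.comp_measurable (by fun_prop)).enorm
    _ ≤ ∫⁻ y, C * ‖a y‖ₑ := by
        refine lintegral_mono_ae (hsupp.mono fun y hy => ?_)
        by_cases hyb : y ∈ Metric.ball c 1
        · rw [lintegral_const_mul' _ _ (by simp), mul_comm]
          gcongr
          refine (lintegral_mono_set fun x hx => ?_).trans
            ((setLIntegral_sub_right (fun z => ‖K z‖ₑ) y 1).trans_le hK.tail)
          rw [mem_ball_iff_norm] at hyb
          have hx' : 2 * 1 ≤ ‖x - c‖ := hx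
          have := norm_sub_norm_le (x - c) (y - c)
          rw [sub_sub_sub_cancel_right] at this
          show 1 ≤ ‖x - y‖
          linarith
        · simp [hy hyb]
    _ = _ := lintegral_const_mul' _ _ (by simp)

end AwayFromSupport

/-! ### Integrable functions as tempered distributions -/

section Distributions
variable {E : Type*} [NormedAddCommGroup E] [InnerProductSpace ℝ E] [FiniteDimensional ℝ E]
  [MeasurableSpace E] [BorelSpace E] {F : Type*} [NormedAddCommGroup F] [NormedSpace ℂ F]
  [CompleteSpace F]

/-- Functions in two Lebesgue spaces, possibly of different exponents, that define the same tempered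
distribution agree almost everywhere. -/
theorem ae_eq_of_toTemperedDistributionCLM_eq {p q : ℝ≥0∞} [hp : Fact (1 ≤ p)] [hq : Fact (1 ≤ q)]
    {f : Lp F p (volume : Measure E)} {g : Lp F q (volume : Measure E)}
    (h : Lp.toTemperedDistributionCLM F volume p f = Lp.toTemperedDistributionCLM F volume q g) :
    f =ᵐ[volume] g := by
  refine ae_eq_of_integral_contDiff_smul_eq ((Lp.memLp f).locallyIntegrable hp.elim)
    ((Lp.memLp g).locallyIntegrable hq.elim) fun φ hφ hc => ?_
  have hg₁ : HasCompactSupport (Complex.ofRealCLM ∘ φ) := hc.comp_left rfl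
  have hg₂ : ContDiff ℝ ((⊤ : ℕ∞) : WithTop ℕ∞) (Complex.ofRealCLM ∘ φ) := by fun_prop
  have := congrArg (fun T => T (hg₁.toSchwartzMap hg₂)) h
  simpa using this

theorem toTemperedDistributionCLM_congr {p q : ℝ≥0∞} [hp : Fact (1 ≤ p)] [hq : Fact (1 ≤ q)]
    {f : Lp F p (volume : Measure E)} {g : Lp F q (volume : Measure E)} (h : f =ᵐ[volume] g) :
    Lp.toTemperedDistributionCLM F volume p f = Lp.toTemperedDistributionCLM F volume q g := by
  ext φ
  simp only [Lp.toTemperedDistributionCLM_apply, Lp.toTemperedDistribution_apply]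
  exact integral_congr_ae (h.mono fun x hx => by simp only [hx])

/-- The distributional Fourier transform of an integrable function is its Fourier integral. -/
theorem fourier_toTemperedDistributionCLM_one (f : Lp F 1 (volume : Measure E))
    {g : Lp F ∞ (volume : Measure E)} (hg : g =ᵐ[volume] 𝓕 (f : E → F)) :
    𝓕 (Lp.toTemperedDistributionCLM F volume 1 f) = Lp.toTemperedDistributionCLM F volume ∞ g := by
  ext φ
  rw [TemperedDistribution.fourier_apply]
  simp only [Lp.toTemperedDistributionCLM_apply, Lp.toTemperedDistribution_apply]
  have h := VectorFourier.integral_fourierIntegral_smul_eq_flip (L := innerₗ E) (f := φ) (g := f)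
    Real.continuous_fourierChar continuous_inner (φ.integrable (μ := volume))
    (L1.integrable_coeFn f)
  rw [flip_innerₗ] at h
  refine Eq.trans ?_ (h.trans (integral_congr_ae (hg.mono fun x hx => ?_)))
  · rfl
  · simp only [hx]; rfl

end Distributions

/-! ### The Fourier transform on `L¹ ∩ L²` -/

section Plancherel
variable {E : Type*} [NormedAddCommGroup E] [InnerProductSpace ℝ E] [FiniteDimensional ℝ E]
  [MeasurableSpace E] [BorelSpace E]

theorem memLp_fourier {F : Type*} [NormedAddCommGroup F] [NormedSpace ℂ F]
    (a : Lp F 1 (volume : Measure E)) : MemLp (𝓕 (a : E → F)) ∞ (volume : Measure E) := by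
  have := memLp_top_of_bound (μ := (volume : Measure E))
    (Real.Lp.fourierTransform a).continuous.aestronglyMeasurable ‖Real.Lp.fourierTransform a‖
    (Filter.Eventually.of_forall fun x => (Real.Lp.fourierTransform a).norm_coe_le_norm x)
  exact this

/-- Plancherel for the Fourier integral of a function in `L¹ ∩ L²`. -/
theorem eLpNorm_fourier_two (a : Lp ℂ 1 (volume : Measure E)) (ha : MemLp a 2 volume) :
    eLpNorm (𝓕 (a : E → ℂ)) 2 (volume : Measure E) = eLpNorm a 2 volume := by
  have h1 := fourier_toTemperedDistributionCLM_one a (memLp_fourier a).coeFn_toLp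
  have h2 : Lp.toTemperedDistributionCLM ℂ volume 1 a =
      Lp.toTemperedDistributionCLM ℂ volume 2 ha.toLp :=
    toTemperedDistributionCLM_congr ha.coeFn_toLp.symm
  have h3 := Lp.fourier_toTemperedDistribution_eq ha.toLp
  rw [h2] at h1
  have h4 : (𝓕 ha.toLp : Lp ℂ 2 (volume : Measure E)) =ᵐ[volume] (memLp_fourier a).toLp :=
    ae_eq_of_toTemperedDistributionCLM_eq (h3.symm.trans h1)
  rw [eLpNorm_congr_ae ((memLp_fourier a).coeFn_toLp.symm.trans h4.symm)]
  have h5 := Lp.norm_fourier_eq ha.toLp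
  rw [Lp.norm_def, Lp.norm_def, ENNReal.toReal_eq_toReal_iff' (Lp.eLpNorm_ne_top _)
    (Lp.eLpNorm_ne_top _), eLpNorm_congr_ae ha.coeFn_toLp] at h5
  exact h5

end Plancherel

/-! ### Size of atoms -/

section Atoms
open scoped Convolution
variable {n : ℕ} {F : Type} [NormedAddCommGroup F]

/-- Cauchy–Schwarz on a set. -/
theorem eLpNorm_one_restrict_le {E : Type*} [MeasurableSpace E] {μ : Measure E} {f : E → F}
    (hf : AEStronglyMeasurable f μ) (s : Set E) :
    ∫⁻ x in s, ‖f x‖ₑ ∂μ ≤ eLpNorm f 2 μ * μ s ^ (1 / 2 : ℝ) := by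
  have h := eLpNorm_le_eLpNorm_mul_rpow_measure_univ (μ := μ.restrict s) (p := 1) (q := 2)
    (by norm_num) hf.restrict
  rw [eLpNorm_one_eq_lintegral_enorm, Measure.restrict_apply_univ] at h
  norm_num at h
  norm_num
  exact h.trans (by gcongr; exact Measure.restrict_le_self)

theorem volume_ball_two_mul (c : EuclideanSpace ℝ (Fin n)) (r : ℝ) :
    volume (Metric.ball c (2 * r)) = 2 ^ n * volume (Metric.ball c r) := by
  rw [Measure.addHaar_ball_mul_of_pos volume c two_pos, Measure.addHaar_ball_center volume c]
  simp [ENNReal.ofReal_pow]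

/-- The part of the definition of an atom that is shared by both kinds of atoms, together with the
estimate away from the support. -/
theorem IsAtom.exists_ball [NormedSpace ℂ F] [CompleteSpace F] {a : L1 n} (ha : IsAtom a) :
    ∃ (c : EuclideanSpace ℝ (Fin n)) (r : ℝ), 0 < r ∧
      (∀ᵐ x, x ∉ Metric.ball c r → a x = 0) ∧
      eLpNorm a 2 volume ≤ volume (Metric.ball c r) ^ (-(1 / 2) : ℝ) ∧
      ∀ (K : EuclideanSpace ℝ (Fin n) → F) (C : ℝ≥0), IsAtomKernel K C →
        ∫⁻ x in {x | 2 * r ≤ ‖x - c‖}, ‖((a : EuclideanSpace ℝ (Fin n) → ℂ)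
          ⋆[ContinuousLinearMap.lsmul ℂ ℂ] K) x‖ₑ ≤ C * ∫⁻ x, ‖a x‖ₑ := by
  have ham : StronglyMeasurable a := Lp.stronglyMeasurable a
  rcases ha with ⟨c, r, hr, hr1, hsupp, hnorm, h0⟩ | ⟨c, hsupp, hnorm⟩
  · refine ⟨c, r, hr, hsupp, hnorm, fun K C hK => ?_⟩
    refine hK.lintegral_convolution_le_of_integral_eq_zero ham (L1.integrable_coeFn a)
      hr hr1 hsupp ?_
    rwa [setIntegral_eq_integral_of_ae_compl_eq_zero hsupp] at h0
  · exact ⟨c, 1, one_pos, hsupp, hnorm, fun K C hK => hK.lintegral_convolution_le ham hsupp⟩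

theorem volume_ball_rpow_mul (c : EuclideanSpace ℝ (Fin n)) {r : ℝ} (hr : 0 < r) :
    volume (Metric.ball c r) ^ (-(1 / 2) : ℝ) * volume (Metric.ball c r) ^ (1 / 2 : ℝ) = 1 := by
  have h1 : volume (Metric.ball c r) ≠ 0 := (Metric.measure_ball_pos volume c hr).ne'
  have h2 : volume (Metric.ball c r) ≠ ∞ := measure_ball_lt_top.ne
  rw [← ENNReal.rpow_add _ _ h1 h2]
  norm_num

/-- Atoms have `L¹` norm at most one. -/
theorem lintegral_enorm_le_one_of_ball {a : L1 n} {c : EuclideanSpace ℝ (Fin n)} {r : ℝ}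
    (hr : 0 < r) (hsupp : ∀ᵐ x, x ∉ Metric.ball c r → a x = 0)
    (hnorm : eLpNorm a 2 volume ≤ volume (Metric.ball c r) ^ (-(1 / 2) : ℝ)) :
    ∫⁻ x, ‖a x‖ₑ ≤ 1 := by
  have h : ∫⁻ x, ‖a x‖ₑ = ∫⁻ x in Metric.ball c r, ‖a x‖ₑ := by
    rw [← lintegral_indicator measurableSet_ball]
    refine lintegral_congr_ae (hsupp.mono fun x hx => ?_)
    by_cases hb : x ∈ Metric.ball c r
    · rw [Set.indicator_of_mem hb]
    · simp [Set.indicator_of_notMem hb, hx hb]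
  rw [h]
  refine (eLpNorm_one_restrict_le (Lp.aestronglyMeasurable a) _).trans
    (le_trans ?_ (volume_ball_rpow_mul c hr).le)
  gcongr

end Atoms

/-! ### Limits in `L²` -/

section Limit
variable {E : Type*} [MeasurableSpace E] {μ : Measure E} {F : Type*} [NormedAddCommGroup F]

/-- Fatou's lemma for a sequence that converges in `L²`, through an almost everywhere convergent
subsequence. -/
theorem setLIntegral_enorm_le_of_tendsto {f : ℕ → Lp F 2 μ} {g : Lp F 2 μ}
    (h : Filter.Tendsto f Filter.atTop (nhds g)) {s : Set E} {C : ℝ≥0∞}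
    (hC : ∀ k, ∫⁻ x in s, ‖f k x‖ₑ ∂μ ≤ C) : ∫⁻ x in s, ‖g x‖ₑ ∂μ ≤ C := by
  obtain ⟨ns, -, hns⟩ := (tendstoInMeasure_of_tendsto_Lp h).exists_seq_tendsto_ae
  calc ∫⁻ x in s, ‖g x‖ₑ ∂μ
      = ∫⁻ x in s, Filter.liminf (fun k => ‖f (ns k) x‖ₑ) Filter.atTop ∂μ := by
        refine lintegral_congr_ae ((ae_restrict_of_ae hns).mono fun x hx => ?_)
        exact (hx.enorm.liminf_eq).symm
    _ ≤ Filter.liminf (fun k => ∫⁻ x in s, ‖f (ns k) x‖ₑ ∂μ) Filter.atTop :=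
        lintegral_liminf_le fun k => (Lp.stronglyMeasurable _).enorm
    _ ≤ C := Filter.liminf_le_of_frequently_le' (Filter.Frequently.of_forall fun k => hC _)

theorem tendsto_toLp_two_of_dominated {f : ℕ → E → F} {g : E → F} {b : E → ℝ}
    (hf : ∀ k, MemLp (f k) 2 μ) (hg : MemLp g 2 μ) (hb : MemLp b 2 μ)
    (hfb : ∀ k x, ‖f k x‖ ≤ b x) (hgb : ∀ x, ‖g x‖ ≤ b x)
    (h : ∀ x, Filter.Tendsto (fun k => f k x) Filter.atTop (nhds (g x))) :
    Filter.Tendsto (fun k => (hf k).toLp) Filter.atTop (nhds hg.toLp) := by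
  rw [Lp.tendsto_Lp_iff_tendsto_eLpNorm'' _ hf _ hg]
  have hd : Filter.Tendsto (fun k => ∫⁻ x, ‖(f k - g) x‖ₑ ^ (2 : ℝ) ∂μ) Filter.atTop
      (nhds (∫⁻ _, 0 ∂μ)) := by
    refine tendsto_lintegral_of_dominated_convergence' (fun x => ‖2 * b x‖ₑ ^ (2 : ℝ))
      (fun k => ((hf k).1.sub hg.1).enorm.pow_const _)
      (fun k => Filter.Eventually.of_forall fun x => ?_) ?_
      (Filter.Eventually.of_forall fun x => ?_)
    · refine ENNReal.rpow_le_rpow ?_ (by norm_num)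
      rw [← ofReal_norm, ← ofReal_norm]
      refine ENNReal.ofReal_le_ofReal ?_
      have := norm_sub_le (f k x) (g x)
      refine le_trans ?_ (le_abs_self _)
      simp only [Pi.sub_apply]
      linarith [hfb k x, hgb x]
    · have := (hb.const_mul 2).eLpNorm_lt_top
      have h2 := lintegral_rpow_enorm_lt_top_of_eLpNorm_lt_top (by norm_num) (by norm_num) this
      simpa using h2.ne
    · have h1 : Filter.Tendsto (fun k => ‖f k x - g x‖ₑ) Filter.atTop (nhds 0) := by
        have := ((h x).sub_const (g x)).enorm
        simpa using this
      have := h1.ennrpow_const 2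
      simpa using this
  simp only [lintegral_zero] at hd
  have h3 := hd.ennrpow_const (1 / 2)
  rw [ENNReal.zero_rpow_of_pos (by norm_num)] at h3
  refine h3.congr fun k => ?_
  rw [eLpNorm_eq_lintegral_rpow_enorm_toReal (by norm_num) (by norm_num)]
  simp

end Limit

/-! ### Multiplier operators on atoms -/

section Multiplier
open scoped Convolution
variable {n : ℕ} {F : Type} [NormedAddCommGroup F] [InnerProductSpace ℂ F]

theorem memLp_two_fourier_smul {a : L1 n} (ha : MemLp a 2 volume)
    {m : EuclideanSpace ℝ (Fin n) → F} (hm : AEStronglyMeasurable m volume) {M : ℝ≥0}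
    (hM : ∀ ξ, ‖m ξ‖ ≤ M) :
    MemLp (fun ξ => 𝓕 (a : EuclideanSpace ℝ (Fin n) → ℂ) ξ • m ξ) 2 volume ∧
      eLpNorm (fun ξ => 𝓕 (a : EuclideanSpace ℝ (Fin n) → ℂ) ξ • m ξ) 2 volume ≤
        M * eLpNorm a 2 volume := by
  have h : eLpNorm (fun ξ => 𝓕 (a : EuclideanSpace ℝ (Fin n) → ℂ) ξ • m ξ) 2 volume ≤
      M * eLpNorm a 2 volume := by
    rw [← eLpNorm_fourier_two a ha]
    have := eLpNorm_le_nnreal_smul_eLpNorm_of_ae_le_mul (c := M) (p := 2) (μ := volume)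
      (f := fun ξ => 𝓕 (a : EuclideanSpace ℝ (Fin n) → ℂ) ξ • m ξ)
      (g := 𝓕 (a : EuclideanSpace ℝ (Fin n) → ℂ)) (Filter.Eventually.of_forall fun ξ => by
        rw [nnnorm_smul, mul_comm]
        gcongr
        exact hM ξ)
    exact this
  exact ⟨⟨(memLp_fourier a).1.smul hm, h.trans_lt (ENNReal.mul_lt_top (by simp) ha.2)⟩, h⟩

variable [CompleteSpace F]

/-- If the bounded symbol `m` is the pointwise limit of the Fourier transforms of kernels satisfying
the atom condition uniformly, then its multiplier operator is bounded from atoms to `L¹`. -/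
theorem exists_toTemperedDistributionCLM_eq_fourierMultiplier_of_isAtom
    {m : EuclideanSpace ℝ (Fin n) → F} (hm : MemLp m ∞ volume)
    {K : ℕ → EuclideanSpace ℝ (Fin n) → F} {C M : ℝ≥0} (hK : ∀ k, IsAtomKernel (K k) C)
    (hM : ∀ ξ, ‖m ξ‖ ≤ M) (hKM : ∀ k ξ, ‖𝓕 (K k) ξ‖ ≤ M)
    (hlim : ∀ ξ, Filter.Tendsto (fun k => 𝓕 (K k) ξ) Filter.atTop (nhds (m ξ))) :
    ∃ D : ℝ≥0, ∀ a : L1 n, IsAtom a →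
      ∃ G : Lp F 1 (volume : Measure (EuclideanSpace ℝ (Fin n))), ‖G‖ ≤ D ∧
        Lp.toTemperedDistributionCLM F volume 1 G = fourierMultiplier m hm a := by
  refine ⟨C + M * ((2 : ℝ≥0) ^ n) ^ (1 / 2 : ℝ), fun a ha => ?_⟩
  obtain ⟨c, r, hr, hsupp, hnorm, hoff⟩ := ha.exists_ball (F := F)
  have ha1 := lintegral_enorm_le_one_of_ball hr hsupp hnorm
  have ha2 : MemLp a 2 volume := by
    refine ⟨Lp.aestronglyMeasurable a, hnorm.trans_lt ?_⟩
    exact (ENNReal.rpow_ne_top_of_ne_zero (Metric.measure_ball_pos volume c hr).ne'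
      measure_ball_lt_top.ne).lt_top
  set ahat : EuclideanSpace ℝ (Fin n) → ℂ := 𝓕 (a : EuclideanSpace ℝ (Fin n) → ℂ) with hahat
  have hKc : ∀ k, Continuous (𝓕 (K k)) := fun k =>
    VectorFourier.fourierIntegral_continuous Real.continuous_fourierChar continuous_inner
      (hK k).integrable
  obtain ⟨hg, hgn⟩ := memLp_two_fourier_smul ha2 hm.1 hM
  have hgk := fun k => (memLp_two_fourier_smul ha2 (hKc k).aestronglyMeasurable (hKM k)).1
  have hbd : MemLp (fun ξ => M * ‖ahat ξ‖) 2 volume := by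
    refine MemLp.const_mul (MemLp.norm ⟨(memLp_fourier a).1, ?_⟩) _
    rw [eLpNorm_fourier_two a ha2]
    exact ha2.2
  have hlim2 : Filter.Tendsto (fun k => (hgk k).toLp) Filter.atTop (nhds hg.toLp) := by
    refine tendsto_toLp_two_of_dominated hgk hg hbd (fun k ξ => ?_) (fun ξ => ?_) fun ξ =>
      (hlim ξ).const_smul _
    · rw [norm_smul, mul_comm]
      gcongr
      exact hKM k ξ
    · rw [norm_smul, mul_comm]
      gcongr
      exact hM ξ
  -- `G` is the image of the atom in `L²`; it is the `L²` limit of the convolutions `a * K k`.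
  set G : Lp F 2 (volume : Measure (EuclideanSpace ℝ (Fin n))) := 𝓕⁻ hg.toLp with hG
  have hGlim : Filter.Tendsto (fun k => (𝓕⁻ (hgk k).toLp :
      Lp F 2 (volume : Measure (EuclideanSpace ℝ (Fin n))))) Filter.atTop (nhds G) :=
    ((Lp.fourierTransformₗᵢ (EuclideanSpace ℝ (Fin n)) F).symm.continuous.tendsto _).comp hlim2
  have hGk : ∀ k, (𝓕⁻ (hgk k).toLp : Lp F 2 (volume : Measure (EuclideanSpace ℝ (Fin n))))
      =ᵐ[volume] (a : EuclideanSpace ℝ (Fin n) → ℂ) ⋆[ContinuousLinearMap.lsmul ℂ ℂ] (K k) := by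
    intro k
    have hci : Integrable ((a : EuclideanSpace ℝ (Fin n) → ℂ)
        ⋆[ContinuousLinearMap.lsmul ℂ ℂ] (K k)) :=
      (L1.integrable_coeFn a).integrable_convolution _ (hK k).integrable
    have hc1 : MemLp _ 1 volume := memLp_one_iff_integrable.2 hci
    have hinf := memLp_fourier_smul (f := a) (memLp_top_of_bound
      (hKc k).aestronglyMeasurable M (Filter.Eventually.of_forall (hKM k)))
    refine (ae_eq_of_toTemperedDistributionCLM_eq ?_).trans hc1.coeFn_toLp
    have h1 := fourier_toTemperedDistributionCLM_one hc1.toLp (g := hinf.toLp) (by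
      refine hinf.coeFn_toLp.trans (Filter.Eventually.of_forall fun ξ => ?_)
      rw [Real.fourier_congr_ae hc1.coeFn_toLp,
        Real.fourier_smul_convolution_eq (L1.integrable_coeFn a) (hK k).integrable]
      rfl)
    have h2 := Lp.fourierInv_toTemperedDistribution_eq (hgk k).toLp
    have h3 : Lp.toTemperedDistributionCLM F volume 2 (hgk k).toLp =
        Lp.toTemperedDistributionCLM F volume ∞ hinf.toLp :=
      toTemperedDistributionCLM_congr ((hgk k).coeFn_toLp.trans hinf.coeFn_toLp.symm)
    rw [Lp.toTemperedDistributionCLM_apply, ← h2, ← Lp.toTemperedDistributionCLM_apply, h3, ← h1,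
      fourierInv_fourier_eq]
  have hfar : ∫⁻ x in {x | 2 * r ≤ ‖x - c‖}, ‖G x‖ₑ ≤ C := by
    refine setLIntegral_enorm_le_of_tendsto hGlim fun k => ?_
    refine (lintegral_congr_ae (ae_restrict_of_ae ((hGk k).mono fun x hx => by
      simp only [hx]))).trans_le ((hoff (K k) C (hK k)).trans ?_)
    calc (C : ℝ≥0∞) * ∫⁻ x, ‖a x‖ₑ ≤ C * 1 := by gcongr
      _ = C := mul_one _
  have hnear : ∫⁻ x in Metric.ball c (2 * r), ‖G x‖ₑ ≤ M * ((2 : ℝ≥0∞) ^ n) ^ (1 / 2 : ℝ) := by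
    refine (eLpNorm_one_restrict_le (Lp.aestronglyMeasurable G) _).trans ?_
    have hGn : eLpNorm G 2 volume ≤ M * eLpNorm a 2 volume := by
      refine le_trans (le_of_eq ?_) hgn
      have h5 := (Lp.fourierTransformₗᵢ (EuclideanSpace ℝ (Fin n)) F).symm.norm_map hg.toLp
      rw [Lp.norm_def, Lp.norm_def, ENNReal.toReal_eq_toReal_iff' (Lp.eLpNorm_ne_top _)
        (Lp.eLpNorm_ne_top _), eLpNorm_congr_ae hg.coeFn_toLp] at h5
      exact h5
    rw [volume_ball_two_mul c r, ENNReal.mul_rpow_of_nonneg _ _ (by norm_num)]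
    calc _ ≤ M * volume (Metric.ball c r) ^ (-(1 / 2) : ℝ) * (((2 : ℝ≥0∞) ^ n) ^ (1 / 2 : ℝ) *
          volume (Metric.ball c r) ^ (1 / 2 : ℝ)) := by
          gcongr; exact hGn.trans (by gcongr)
      _ = M * ((2 : ℝ≥0∞) ^ n) ^ (1 / 2 : ℝ) * (volume (Metric.ball c r) ^ (-(1 / 2) : ℝ) *
          volume (Metric.ball c r) ^ (1 / 2 : ℝ)) := by ring
      _ = _ := by rw [volume_ball_rpow_mul c hr, mul_one]
  have hG1 : eLpNorm G 1 volume ≤ ((C + M * ((2 : ℝ≥0) ^ n) ^ (1 / 2 : ℝ) : ℝ≥0) : ℝ≥0∞) := by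
    rw [eLpNorm_one_eq_lintegral_enorm, ← lintegral_add_compl _
      (measurableSet_ball (x := c) (ε := 2 * r))]
    have hset : (Metric.ball c (2 * r))ᶜ = {x | 2 * r ≤ ‖x - c‖} := by
      ext x; simp [dist_eq_norm]
    rw [hset, add_comm]
    push_cast
    rw [ENNReal.coe_rpow_of_nonneg _ (by norm_num)]
    push_cast
    exact add_le_add hfar hnear
  have hGmem : MemLp G 1 volume := ⟨Lp.aestronglyMeasurable G, hG1.trans_lt ENNReal.coe_lt_top⟩
  refine ⟨hGmem.toLp, ?_, ?_⟩
  · rw [Lp.norm_toLp]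
    exact ENNReal.toReal_le_coe_of_le_coe hG1
  · rw [toTemperedDistributionCLM_congr hGmem.coeFn_toLp]
    have h2 := Lp.fourierInv_toTemperedDistribution_eq hg.toLp
    have h3 : Lp.toTemperedDistributionCLM F volume 2 hg.toLp =
        Lp.toTemperedDistributionCLM F volume ∞ (memLp_fourier_smul hm a).toLp :=
      toTemperedDistributionCLM_congr
        (hg.coeFn_toLp.trans (memLp_fourier_smul hm a).coeFn_toLp.symm)
    rw [Lp.toTemperedDistributionCLM_apply, hG, ← h2, ← Lp.toTemperedDistributionCLM_apply, h3]
    rfl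

end Multiplier

/-! ### Multiplier operators on atomic decompositions -/

section MultiplierSum
variable {n : ℕ} {F : Type} [NormedAddCommGroup F] [NormedSpace ℂ F]

theorem hasSum_fourier {f : ℕ → Lp F 1 (volume : Measure (EuclideanSpace ℝ (Fin n)))}
    {g : Lp F 1 (volume : Measure (EuclideanSpace ℝ (Fin n)))} {l : ℕ → ℂ}
    (h : HasSum (fun j => l j • f j) g) (ξ : EuclideanSpace ℝ (Fin n)) :
    HasSum (fun j => l j • 𝓕 (f j : EuclideanSpace ℝ (Fin n) → F) ξ)
      (𝓕 (g : EuclideanSpace ℝ (Fin n) → F) ξ) := by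
  have h1 := h.mapL (Real.Lp.fourierTransformCLM (EuclideanSpace ℝ (Fin n)) F)
  have h2 := h1.mapL (BoundedContinuousFunction.evalCLM ℂ ξ)
  simpa using h2

variable [CompleteSpace F]

/-- Equality with a multiplier operator can be tested on the Fourier side. -/
theorem toTemperedDistributionCLM_eq_fourierMultiplier_iff
    {m : EuclideanSpace ℝ (Fin n) → F} (hm : MemLp m ∞ volume) (f : L1 n)
    (G : Lp F 1 (volume : Measure (EuclideanSpace ℝ (Fin n)))) :
    Lp.toTemperedDistributionCLM F volume 1 G = fourierMultiplier m hm f ↔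
      ∀ᵐ ξ, 𝓕 (G : EuclideanSpace ℝ (Fin n) → F) ξ =
        𝓕 (f : EuclideanSpace ℝ (Fin n) → ℂ) ξ • m ξ := by
  have h1 := fourier_toTemperedDistributionCLM_one G (memLp_fourier G).coeFn_toLp
  have h2 : fourierMultiplier m hm f =
      𝓕⁻ (Lp.toTemperedDistributionCLM F volume ∞ (memLp_fourier_smul hm f).toLp) := rfl
  have hc := (memLp_fourier_smul hm f).coeFn_toLp
  constructor
  · intro h
    rw [h, h2, fourier_fourierInv_eq] at h1
    have h3 := ae_eq_of_toTemperedDistributionCLM_eq h1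
    filter_upwards [h3, hc, (memLp_fourier G).coeFn_toLp] with ξ e1 e2 e3
    rw [← e3, ← e1, e2]
    rfl
  · intro h
    have h3 : Lp.toTemperedDistributionCLM F volume ∞ (memLp_fourier G).toLp =
        Lp.toTemperedDistributionCLM F volume ∞ (memLp_fourier_smul hm f).toLp := by
      refine toTemperedDistributionCLM_congr ?_
      filter_upwards [h, hc, (memLp_fourier G).coeFn_toLp] with ξ e1 e2 e3
      rw [e2, e3, e1]
      rfl
    rw [h2, ← h3, ← h1, fourierInv_fourier_eq]

/-- A multiplier operator that is bounded from atoms to `L¹` extends along atomic decompositions.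
Continuity of the operator from `L¹` to tempered distributions is not needed, because the sum can be
taken pointwise on the Fourier side. -/
theorem exists_of_isAtomicDecomp {m : EuclideanSpace ℝ (Fin n) → F} (hm : MemLp m ∞ volume)
    {D : ℝ≥0}
    (hD : ∀ a : L1 n, IsAtom a →
      ∃ G : Lp F 1 (volume : Measure (EuclideanSpace ℝ (Fin n))), ‖G‖ ≤ D ∧
        Lp.toTemperedDistributionCLM F volume 1 G = fourierMultiplier m hm a)
    {g : L1 n} {l : ℕ → ℂ} {a : ℕ → L1 n} (h : IsAtomicDecomp g l a) :
    ∃ G : Lp F 1 (volume : Measure (EuclideanSpace ℝ (Fin n))), ‖G‖ ≤ D * ∑' j, ‖l j‖ ∧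
        Lp.toTemperedDistributionCLM F volume 1 G = fourierMultiplier m hm g := by
  obtain ⟨ha, hl, hg⟩ := h
  choose G hG hGa using fun j => hD (a j) (ha j)
  have hb : ∀ j, ‖l j • G j‖ ≤ D * ‖l j‖ := fun j => by
    rw [norm_smul, mul_comm]
    gcongr
    exact hG j
  have hs : Summable fun j => l j • G j := (hl.mul_left (D : ℝ)).of_norm_bounded hb
  refine ⟨∑' j, l j • G j, ?_, ?_⟩
  · rw [← tsum_mul_left]
    exact tsum_of_norm_bounded (hl.mul_left (D : ℝ)).hasSum hb
  · rw [toTemperedDistributionCLM_eq_fourierMultiplier_iff]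
    have h1 : ∀ᵐ ξ, ∀ j, 𝓕 (G j : EuclideanSpace ℝ (Fin n) → F) ξ =
        𝓕 (a j : EuclideanSpace ℝ (Fin n) → ℂ) ξ • m ξ :=
      ae_all_iff.2 fun j =>
        (toTemperedDistributionCLM_eq_fourierMultiplier_iff hm (a j) (G j)).1 (hGa j)
    filter_upwards [h1] with ξ hξ
    have h2 := hasSum_fourier hs.hasSum ξ
    have h3 := (hasSum_fourier hg ξ).smul_const (m ξ)
    refine h2.unique (h3.congr_fun ?_)
    intro j
    rw [hξ j, smul_assoc]

end MultiplierSum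

/-! ### Truncated Gaussian integrals -/

section GaussianMass

/-- The integral `∫_{t > ε} (2/√π) exp (-(1 + s) t²) dt`, which increases to `(1 + s)^{-1/2}` as
`ε → 0`. -/
def gaussianMass (ε s : ℝ) : ℝ := ∫ t in Set.Ioi ε, 2 / √Real.pi * Real.exp (-(1 + s) * t ^ 2)

theorem integral_Ioi_two_div_sqrt_pi (b : ℝ) :
    ∫ t in Set.Ioi (0 : ℝ), 2 / √Real.pi * Real.exp (-b * t ^ 2) = (√b)⁻¹ := by
  have := Real.sqrt_pos.2 Real.pi_pos
  rw [integral_const_mul, integral_gaussian_Ioi, Real.sqrt_div Real.pi_pos.le]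
  field_simp

theorem gaussianMass_zero (s : ℝ) : gaussianMass 0 s = (√(1 + s))⁻¹ :=
  integral_Ioi_two_div_sqrt_pi _

theorem integrable_gaussianMass {s : ℝ} (hs : 0 ≤ s) :
    Integrable fun t : ℝ => 2 / √Real.pi * Real.exp (-(1 + s) * t ^ 2) :=
  (integrable_exp_neg_mul_sq (by linarith)).const_mul _

theorem gaussianMass_nonneg (ε s : ℝ) : 0 ≤ gaussianMass ε s :=
  integral_nonneg fun t => by positivity

theorem gaussianMass_le {ε s : ℝ} (hε : 0 ≤ ε) (hs : 0 ≤ s) :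
    gaussianMass ε s ≤ gaussianMass 0 s :=
  setIntegral_mono_set (integrable_gaussianMass hs).integrableOn
    (Filter.Eventually.of_forall fun t => by simp only [Pi.zero_apply]; positivity)
    (Set.Ioi_subset_Ioi hε).eventuallyLE

theorem tendsto_gaussianMass {s : ℝ} (hs : 0 ≤ s) :
    Filter.Tendsto (fun k : ℕ => gaussianMass (1 / ((k : ℝ) + 1)) s) Filter.atTop
      (nhds (gaussianMass 0 s)) := by
  have hU : ⋃ k : ℕ, Set.Ioi (1 / ((k : ℝ) + 1)) = Set.Ioi 0 := by
    ext t
    simp only [Set.mem_iUnion, Set.mem_Ioi]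
    exact ⟨fun ⟨k, hk⟩ => lt_trans (by positivity) hk, fun ht => exists_nat_one_div_lt ht⟩
  have := tendsto_setIntegral_of_monotone (μ := volume)
    (s := fun k : ℕ => Set.Ioi (1 / ((k : ℝ) + 1)))
    (f := fun t : ℝ => 2 / √Real.pi * Real.exp (-(1 + s) * t ^ 2)) (fun k => measurableSet_Ioi)
    (fun i j hij => Set.Ioi_subset_Ioi (one_div_le_one_div_of_le (by positivity) (by gcongr)))
    (integrable_gaussianMass hs).integrableOn
  rwa [hU] at this

end GaussianMass

/-! ### Fourier transforms of kernels and profiles -/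

section Symbols
variable {n : ℕ} {F : Type} [NormedAddCommGroup F] [NormedSpace ℂ F]

theorem lapSymbol_smul (t : ℝ) (ξ : EuclideanSpace ℝ (Fin n)) :
    lapSymbol (t • ξ) = t ^ 2 * lapSymbol ξ := by
  rw [lapSymbol, lapSymbol, norm_smul, mul_pow, mul_pow, mul_pow, Real.norm_eq_abs, sq_abs]
  ring

theorem fourier_truncKernel [CompleteSpace F] {ψ : EuclideanSpace ℝ (Fin n) → F} (hψ : IsProfile ψ)
    {A : EuclideanSpace ℝ (Fin n) → F} (hA : ∀ t : ℝ, 0 < t → ∀ ξ, A (t • ξ) = t • A ξ)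
    (hψA : ∀ ξ, 𝓕 ψ ξ = Real.exp (-lapSymbol ξ) • A ξ) {ε : ℝ} (hε : 0 < ε)
    (ξ : EuclideanSpace ℝ (Fin n)) :
    𝓕 (truncKernel ψ ε) ξ = gaussianMass ε (lapSymbol ξ) • A ξ := by
  have := isFiniteMeasure_scaleMeasure hε
  rw [truncKernel, fourier_superpose hψ.stronglyMeasurable hψ.lintegral_lt_top measurable_id
    (ae_scaleMeasure_pos hε.le), scaleMeasure, integral_withDensity_eq_integral_toReal_smul
    measurable_scaleDensity.ennreal_ofReal (by simp), gaussianMass, ← integral_smul_const]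
  refine setIntegral_congr_fun measurableSet_Ioi fun t ht => ?_
  have ht0 : 0 < t := hε.trans ht
  simp only [id]
  rw [ENNReal.toReal_ofReal (scaleDensity_nonneg ht0), hψA, hA t ht0, lapSymbol_smul, smul_smul,
    smul_smul, scaleDensity]
  congr 1
  rw [show -(1 + lapSymbol ξ) * t ^ 2 = -t ^ 2 + -(t ^ 2 * lapSymbol ξ) by ring, Real.exp_add]
  field_simp

/-- The measure `(2/√π) (1 + t²)⁻¹ dt` on `t > 0`, with which the dilates to the scales `√(1 + t²)`
are superposed. -/
def heatTailMeasure : Measure ℝ :=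
  (volume.restrict (Set.Ioi 0)).withDensity fun t =>
    ENNReal.ofReal (2 / √Real.pi * (1 + t ^ 2)⁻¹)

instance : IsFiniteMeasure heatTailMeasure := by
  refine isFiniteMeasure_withDensity_ofReal ?_
  exact ((integrable_inv_one_add_sq).const_mul _).restrict.2

theorem lintegral_heatTailMeasure_lt_top :
    ∫⁻ t, ENNReal.ofReal √(1 + t ^ 2) ^ (1 / 2 : ℝ) ∂heatTailMeasure < ∞ := by
  rw [heatTailMeasure, lintegral_withDensity_eq_lintegral_mul _ (by fun_prop) (by fun_prop)]
  have hi : Integrable fun t : ℝ => 2 / √Real.pi * (1 + ‖t‖ ^ 2) ^ (-(3 / 2) / 2 : ℝ) :=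
    (integrable_rpow_neg_one_add_norm_sq (by norm_num)).const_mul _
  refine lt_of_le_of_lt ((setLIntegral_le_lintegral _ _).trans (lintegral_mono fun t => ?_)) hi.2
  have h1 : 0 < 1 + t ^ 2 := by positivity
  rw [Pi.mul_apply, Real.sqrt_eq_rpow (1 + t ^ 2),
    ENNReal.ofReal_rpow_of_nonneg (by positivity) (by norm_num),
    ← ENNReal.ofReal_mul (by positivity), ← Real.rpow_mul h1.le, mul_assoc, ← Real.rpow_neg_one,
    ← Real.rpow_add h1, ← ofReal_norm]
  refine ENNReal.ofReal_le_ofReal (le_trans (le_of_eq ?_) (le_abs_self _))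
  simp only [Real.norm_eq_abs, sq_abs]
  norm_num

theorem lintegral_heatTailMeasure_inv_lt_top :
    ∫⁻ t, ENNReal.ofReal (√(1 + t ^ 2))⁻¹ ∂heatTailMeasure < ∞ := by
  refine lt_of_le_of_lt (lintegral_mono (g := fun _ => 1) fun t => ?_) (by simp)
  refine ENNReal.ofReal_le_one.2 (inv_le_one_of_one_le₀ ?_)
  exact Real.one_le_sqrt.2 (by nlinarith [sq_nonneg t])

/-- Applying `𝓛^{-1/2}` to a profile. If `B` is homogeneous of degree two, the dilate to the scale
`√(1 + t²)` has the Fourier transform `e^{-s} e^{-s t²} (1 + t²) B`; the weight cancels `1 + t²`,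
and the integral over `t` of the Gaussian that is left is `s^{-1/2}`. -/
theorem IsProfile.exists_div_sqrt [CompleteSpace F] {ψ : EuclideanSpace ℝ (Fin n) → F}
    (hψ : IsProfile ψ)
    {B : EuclideanSpace ℝ (Fin n) → F} (hB : ∀ t : ℝ, 0 < t → ∀ ξ, B (t • ξ) = t ^ 2 • B ξ)
    (hψB : ∀ ξ, 𝓕 ψ ξ = Real.exp (-lapSymbol ξ) • B ξ) :
    ∃ Ψ : EuclideanSpace ℝ (Fin n) → F, IsProfile Ψ ∧
      ∀ ξ, 𝓕 Ψ ξ = Real.exp (-lapSymbol ξ) • (√(lapSymbol ξ))⁻¹ • B ξ := by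
  have hσ : Measurable fun t : ℝ => √(1 + t ^ 2) := by fun_prop
  have h0 : ∀ t : ℝ, 0 < √(1 + t ^ 2) := fun t => by positivity
  have h0' : ∀ᵐ t ∂heatTailMeasure, 0 < √(1 + t ^ 2) := Filter.Eventually.of_forall h0
  refine ⟨superpose heatTailMeasure (fun t => √(1 + t ^ 2)) ψ, isProfile_superpose hψ hσ h0'
    lintegral_heatTailMeasure_lt_top lintegral_heatTailMeasure_inv_lt_top, fun ξ => ?_⟩
  rw [fourier_superpose hψ.stronglyMeasurable hψ.lintegral_lt_top hσ h0', heatTailMeasure,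
    integral_withDensity_eq_integral_toReal_smul (by fun_prop) (by simp),
    ← integral_Ioi_two_div_sqrt_pi, smul_smul, ← integral_const_mul, ← integral_smul_const]
  refine setIntegral_congr_fun measurableSet_Ioi fun t ht => ?_
  have h1 : 0 < 1 + t ^ 2 := by positivity
  rw [ENNReal.toReal_ofReal (by positivity), hψB, hB _ (h0 t), lapSymbol_smul, Real.sq_sqrt h1.le,
    smul_smul, smul_smul]
  congr 1
  rw [show -((1 + t ^ 2) * lapSymbol ξ) = -lapSymbol ξ + -lapSymbol ξ * t ^ 2 by ring, Real.exp_add]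
  field_simp

/-- A smooth symbol of temperate growth times `e^{-s}` is the Fourier transform of a Schwartz
function. -/
theorem exists_schwartzMap_fourier_eq [CompleteSpace F] {A : EuclideanSpace ℝ (Fin n) → F}
    (hA : A.HasTemperateGrowth) : ∃ φ : 𝓢(EuclideanSpace ℝ (Fin n), F),
      ∀ ξ, 𝓕 (φ : EuclideanSpace ℝ (Fin n) → F) ξ = Real.exp (-lapSymbol ξ) • A ξ := by
  have hb : 0 < (2 * Real.pi) ^ 2 := by positivity
  refine ⟨𝓕⁻ (SchwartzMap.bilinLeftCLM (ContinuousLinearMap.lsmul ℂ ℂ) hA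
    (gaussian (EuclideanSpace ℝ (Fin n)) hb)), fun ξ => ?_⟩
  rw [← SchwartzMap.fourier_coe, fourier_fourierInv_eq, SchwartzMap.bilinLeftCLM_apply, lapSymbol,
    mul_pow _ ‖ξ‖]
  simp only [gaussian_apply, ContinuousLinearMap.lsmul_apply, Complex.coe_smul]

end Symbols

/-! ### Multipliers generated by a profile -/

section AtomBound
variable {n : ℕ} {F : Type} [NormedAddCommGroup F] [InnerProductSpace ℂ F] [CompleteSpace F]

/-- The multiplier operator with symbol `(1 + s)^{-1/2} A`, where `A` is homogeneous of degree one
and `e^{-s} A` is the Fourier transform of a profile, is bounded from atoms to `L¹`. -/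
theorem IsProfile.exists_bound_fourierMultiplier {ψ : EuclideanSpace ℝ (Fin n) → F}
    (hψ : IsProfile ψ)
    {A : EuclideanSpace ℝ (Fin n) → F} (hA : ∀ t : ℝ, 0 < t → ∀ ξ, A (t • ξ) = t • A ξ)
    (hψA : ∀ ξ, 𝓕 ψ ξ = Real.exp (-lapSymbol ξ) • A ξ)
    {m : EuclideanSpace ℝ (Fin n) → F} (hm : MemLp m ∞ volume)
    (hmA : ∀ ξ, m ξ = (√(1 + lapSymbol ξ))⁻¹ • A ξ) {M : ℝ≥0} (hM : ∀ ξ, ‖m ξ‖ ≤ M) :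
    ∃ D : ℝ≥0, ∀ a : L1 n, IsAtom a →
      ∃ G : Lp F 1 (volume : Measure (EuclideanSpace ℝ (Fin n))), ‖G‖ ≤ D ∧
        Lp.toTemperedDistributionCLM F volume 1 G = fourierMultiplier m hm a := by
  obtain ⟨C, hC⟩ := hψ.exists_isAtomKernel
  have hε : ∀ k : ℕ, 0 < 1 / ((k : ℝ) + 1) := fun k => by positivity
  refine exists_toTemperedDistributionCLM_eq_fourierMultiplier_of_isAtom hm
    (fun k => hC _ (hε k)) hM (fun k ξ => ?_) fun ξ => ?_
  · rw [fourier_truncKernel hψ hA hψA (hε k)]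
    refine le_trans ?_ (hM ξ)
    rw [hmA, ← gaussianMass_zero, norm_smul, norm_smul,
      Real.norm_of_nonneg (gaussianMass_nonneg _ _),
      Real.norm_of_nonneg (gaussianMass_nonneg _ _)]
    gcongr
    exact gaussianMass_le (hε k).le (lapSymbol_nonneg ξ)
  · simp only [fun k => fourier_truncKernel hψ hA hψA (hε k) ξ]
    rw [hmA, ← gaussianMass_zero]
    exact (tendsto_gaussianMass (lapSymbol_nonneg ξ)).smul_const _

end AtomBound

/-! ### The symbols of `𝓤^{1/2}` and `𝓡 𝓤^{1/2}` -/

section ConcreteSymbols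
variable {n : ℕ}

/-- The symbol `2πi ξ` of the gradient, as a linear map in `ξ`. -/
def gradSymbol (n : ℕ) : EuclideanSpace ℝ (Fin n) →ₗ[ℝ] EuclideanSpace ℂ (Fin n) where
  toFun ξ := WithLp.toLp 2 fun j => 2 * Real.pi * Complex.I * (ξ j : ℂ)
  map_add' ξ η := by ext j; simp [mul_add]
  map_smul' c ξ := by ext j; simp; ring

theorem hasTemperateGrowth_gradSymbol (n : ℕ) : (gradSymbol n : _ → _).HasTemperateGrowth :=
  (LinearMap.toContinuousLinearMap (gradSymbol n)).hasTemperateGrowth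

theorem sqrt_lapSymbol (ξ : EuclideanSpace ℝ (Fin n)) : √(lapSymbol ξ) = 2 * Real.pi * ‖ξ‖ :=
  Real.sqrt_sq (by positivity)

theorem norm_gradSymbol (ξ : EuclideanSpace ℝ (Fin n)) : ‖gradSymbol n ξ‖ = √(lapSymbol ξ) := by
  have h : gradSymbol n ξ = ((2 * Real.pi : ℝ) * Complex.I) •
      (WithLp.toLp 2 fun j => (ξ j : ℂ) : EuclideanSpace ℂ (Fin n)) := by
    ext j; simp [gradSymbol]
  have h2 : ‖(WithLp.toLp 2 fun j => (ξ j : ℂ) : EuclideanSpace ℂ (Fin n))‖ = ‖ξ‖ := by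
    simp [EuclideanSpace.norm_eq]
  rw [h, norm_smul, h2, sqrt_lapSymbol, norm_mul, Complex.norm_I, Complex.norm_real,
    Real.norm_of_nonneg (by positivity), mul_one]

theorem rieszSymbol_eq (ξ : EuclideanSpace ℝ (Fin n)) :
    rieszSymbol ξ = (√(lapSymbol ξ))⁻¹ • gradSymbol n ξ := by
  ext j
  simp only [rieszSymbol, gradSymbol, LinearMap.coe_mk, AddHom.coe_mk, PiLp.smul_apply,
    Complex.real_smul]
  rw [Real.rpow_neg (lapSymbol_nonneg ξ), ← Real.sqrt_eq_rpow]
  ring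

theorem uHalfSymbol_eq (ξ : EuclideanSpace ℝ (Fin n)) :
    uHalfSymbol ξ = (√(1 + lapSymbol ξ))⁻¹ • ((√(lapSymbol ξ) : ℝ) : ℂ) := by
  rw [uHalfSymbol, Real.rpow_neg (by linarith [lapSymbol_nonneg ξ]), ← Real.sqrt_eq_rpow,
    ← Real.sqrt_eq_rpow, Complex.real_smul, mul_comm, Complex.ofReal_mul]

theorem continuous_lapSymbol : Continuous (lapSymbol (n := n)) := by
  unfold lapSymbol; fun_prop

theorem continuous_uHalfSymbol : Continuous (uHalfSymbol (n := n)) := by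
  have h := continuous_lapSymbol (n := n)
  have h0 : ∀ ξ : EuclideanSpace ℝ (Fin n), √(1 + lapSymbol ξ) ≠ 0 := fun ξ =>
    (Real.sqrt_pos.2 (by linarith [lapSymbol_nonneg ξ])).ne'
  rw [funext uHalfSymbol_eq]
  exact ((continuous_const.add h).sqrt.inv₀ h0).smul (Complex.continuous_ofReal.comp h.sqrt)

theorem norm_uHalfSymbol_le (ξ : EuclideanSpace ℝ (Fin n)) : ‖uHalfSymbol ξ‖ ≤ 1 := by
  have h := lapSymbol_nonneg ξ
  rw [uHalfSymbol_eq, norm_smul, Complex.norm_real, Real.norm_of_nonneg (by positivity),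
    Real.norm_of_nonneg (by positivity)]
  exact inv_mul_le_one_of_le₀ (Real.sqrt_le_sqrt (by linarith)) (by positivity)

theorem norm_rieszSymbol_le (ξ : EuclideanSpace ℝ (Fin n)) : ‖rieszSymbol ξ‖ ≤ 1 := by
  rw [rieszSymbol_eq, norm_smul, norm_gradSymbol, Real.norm_of_nonneg (by positivity)]
  exact inv_mul_le_one_of_le₀ le_rfl (by positivity)

theorem uHalfSymbol_ne_zero {ξ : EuclideanSpace ℝ (Fin n)} (hξ : ξ ≠ 0) : uHalfSymbol ξ ≠ 0 := by
  have h1 : 0 < √(1 + lapSymbol ξ) := Real.sqrt_pos.2 (by linarith [lapSymbol_nonneg ξ])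
  have h2 : √(lapSymbol ξ) ≠ 0 := by
    rw [sqrt_lapSymbol]
    have := norm_pos_iff.2 hξ
    positivity
  rw [uHalfSymbol_eq]
  exact smul_ne_zero (inv_ne_zero h1.ne') (Complex.ofReal_ne_zero.2 h2)

/-- The symbol of `𝓡 𝓤^{1/2} = ∇ (I + 𝓛)^{-1/2}`, the local Riesz transforms. -/
def localRieszSymbol (ξ : EuclideanSpace ℝ (Fin n)) : EuclideanSpace ℂ (Fin n) :=
  uHalfSymbol ξ • rieszSymbol ξ

theorem localRieszSymbol_eq (ξ : EuclideanSpace ℝ (Fin n)) :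
    localRieszSymbol ξ = (√(1 + lapSymbol ξ))⁻¹ • gradSymbol n ξ := by
  rw [localRieszSymbol, uHalfSymbol_eq, rieszSymbol_eq, smul_assoc, Complex.coe_smul, smul_smul √_]
  by_cases h : √(lapSymbol ξ) = 0
  · have : gradSymbol n ξ = 0 := by rw [← norm_eq_zero, norm_gradSymbol, h]
    simp [this]
  · rw [mul_inv_cancel₀ h, one_smul]

theorem norm_localRieszSymbol_le (ξ : EuclideanSpace ℝ (Fin n)) : ‖localRieszSymbol ξ‖ ≤ 1 := by
  rw [localRieszSymbol, norm_smul]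
  exact mul_le_one₀ (norm_uHalfSymbol_le ξ) (norm_nonneg _) (norm_rieszSymbol_le ξ)

theorem memLp_localRieszSymbol (n : ℕ) :
    MemLp (localRieszSymbol (n := n)) ∞ (volume : Measure (EuclideanSpace ℝ (Fin n))) :=
  memLp_top_of_bound ((memLp_uHalfSymbol n).1.smul (memLp_rieszSymbol n).1) 1
    (Filter.Eventually.of_forall norm_localRieszSymbol_le)

/-- `𝓤^{1/2}` is bounded from atoms to `L¹`; the profile has the Fourier transform
`√s e^{-s} = s^{-1/2} · s e^{-s}`. -/
theorem exists_bound_uHalf (n : ℕ) : ∃ D : ℝ≥0, ∀ a : L1 n, IsAtom a → ∃ f : L1 n, ‖f‖ ≤ D ∧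
    Lp.toTemperedDistributionCLM ℂ volume 1 f = uHalf n a := by
  have hT : (fun ξ : EuclideanSpace ℝ (Fin n) => ((lapSymbol ξ : ℝ) : ℂ)).HasTemperateGrowth := by
    simp only [lapSymbol, mul_pow _ ‖_‖]
    have := Function.hasTemperateGrowth_norm_sq (H := EuclideanSpace ℝ (Fin n))
    exact Function.Complex.hasTemperateGrowth_ofReal.comp
      ((Function.HasTemperateGrowth.const _).mul this)
  obtain ⟨φ, hφ⟩ := exists_schwartzMap_fourier_eq hT
  obtain ⟨ψ, hψ, hψA⟩ := (isProfile_schwartzMap φ).exists_div_sqrt (fun t _ ξ => by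
    simp [lapSymbol_smul]) hφ
  refine hψ.exists_bound_fourierMultiplier (A := fun ξ => ((√(lapSymbol ξ) : ℝ) : ℂ))
    (fun t ht ξ => ?_) (fun ξ => ?_) (memLp_uHalfSymbol n) uHalfSymbol_eq (M := 1)
    norm_uHalfSymbol_le
  · rw [sqrt_lapSymbol, sqrt_lapSymbol, norm_smul, Real.norm_of_nonneg ht.le, Complex.real_smul,
      ← Complex.ofReal_mul]
    ring_nf
  · rw [hψA]
    congr 1
    rw [Complex.real_smul, ← Complex.ofReal_mul, inv_mul_eq_div, Real.div_sqrt]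

/-- `𝓡 𝓤^{1/2}` is bounded from atoms to `L¹`; the profile is the Schwartz function with Fourier
transform `2πi ξ e^{-s}`. -/
theorem exists_bound_localRiesz (n : ℕ) : ∃ D : ℝ≥0, ∀ a : L1 n, IsAtom a →
    ∃ G : Lp (EuclideanSpace ℂ (Fin n)) 1 (volume : Measure (EuclideanSpace ℝ (Fin n))), ‖G‖ ≤ D ∧
      Lp.toTemperedDistributionCLM _ volume 1 G =
        fourierMultiplier localRieszSymbol (memLp_localRieszSymbol n) a := by
  obtain ⟨φ, hφ⟩ := exists_schwartzMap_fourier_eq (hasTemperateGrowth_gradSymbol n)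
  exact (isProfile_schwartzMap φ).exists_bound_fourierMultiplier
    (fun t _ ξ => map_smul (gradSymbol n) t ξ) hφ (memLp_localRieszSymbol n) localRieszSymbol_eq
    (M := 1) norm_localRieszSymbol_le

end ConcreteSymbols

/-! ### The operator `𝓤^{1/2}` on the Goldberg space -/

section Operator
variable {n : ℕ}

theorem toTemperedDistributionCLM_injective {F : Type} [NormedAddCommGroup F] [NormedSpace ℂ F]
    [CompleteSpace F] {f g : Lp F 1 (volume : Measure (EuclideanSpace ℝ (Fin n)))}
    (h : Lp.toTemperedDistributionCLM F volume 1 f = Lp.toTemperedDistributionCLM F volume 1 g) :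
    f = g :=
  Lp.ext (ae_eq_of_toTemperedDistributionCLM_eq h)

/-- If `f = 𝓤^{1/2} g` then `𝓡 f` is the image of `g` under the local Riesz transforms. -/
theorem toTemperedDistributionCLM_eq_riesz {f g : L1 n}
    {G : Lp (EuclideanSpace ℂ (Fin n)) 1 (volume : Measure (EuclideanSpace ℝ (Fin n)))}
    (hf : Lp.toTemperedDistributionCLM ℂ volume 1 f = uHalf n g)
    (hG : Lp.toTemperedDistributionCLM _ volume 1 G =
      fourierMultiplier localRieszSymbol (memLp_localRieszSymbol n) g) :
    Lp.toTemperedDistributionCLM _ volume 1 G = riesz n f := by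
  have hf' := (toTemperedDistributionCLM_eq_fourierMultiplier_iff _ _ _).1 hf
  have hG' := (toTemperedDistributionCLM_eq_fourierMultiplier_iff _ _ _).1 hG
  refine (toTemperedDistributionCLM_eq_fourierMultiplier_iff _ _ _).2 ?_
  filter_upwards [hf', hG'] with ξ h1 h2
  rw [h1, h2, localRieszSymbol, smul_assoc]

/-- The representative of `𝓡 f` in `L¹` is unique, so the choice made in `rieszL1` is harmless. -/
theorem rieszL1_eq {f : H1 n}
    {G : Lp (EuclideanSpace ℂ (Fin n)) 1 (volume : Measure (EuclideanSpace ℝ (Fin n)))}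
    (hG : Lp.toTemperedDistributionCLM _ volume 1 G = riesz n (f : L1 n)) : rieszL1 f = G :=
  toTemperedDistributionCLM_injective ((rieszL1_spec f).trans hG.symm)

/-- Each atomic decomposition of `g` bounds the Hardy norm of `𝓤^{1/2} g`. -/
theorem exists_of_goldberg (n : ℕ) : ∃ C : ℝ≥0, ∀ (g : L1 n) (l : ℕ → ℂ) (a : ℕ → L1 n),
    IsAtomicDecomp g l a → ∃ f : H1 n,
      Lp.toTemperedDistributionCLM ℂ volume 1 (f : L1 n) = uHalf n g ∧
        hardyNorm f ≤ C * ∑' j, ‖l j‖ := by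
  obtain ⟨D, hD⟩ := exists_bound_uHalf n
  obtain ⟨D', hD'⟩ := exists_bound_localRiesz n
  refine ⟨D + D', fun g l a h => ?_⟩
  obtain ⟨f, hfn, hf⟩ := exists_of_isAtomicDecomp (memLp_uHalfSymbol n) hD h
  obtain ⟨G, hGn, hG⟩ := exists_of_isAtomicDecomp (memLp_localRieszSymbol n) hD' h
  have hr := toTemperedDistributionCLM_eq_riesz hf hG
  refine ⟨⟨f, G, hr⟩, hf, ?_⟩
  rw [hardyNorm, rieszL1_eq (f := ⟨f, G, hr⟩) hr, NNReal.coe_add, add_mul]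
  exact add_le_add hfn hGn

theorem exists_linearMap_uHalf (n : ℕ) : ∃ T : goldberg n →ₗ[ℂ] H1 n,
    (∀ g : goldberg n, Lp.toTemperedDistributionCLM ℂ volume 1 (T g : L1 n) = uHalf n (g : L1 n)) ∧
      ∃ C : ℝ, ∀ g : goldberg n, hardyNorm (T g) ≤ C * goldbergNorm g := by
  obtain ⟨C, hC⟩ := exists_of_goldberg n
  have hex : ∀ g : goldberg n, ∃ f : H1 n,
      Lp.toTemperedDistributionCLM ℂ volume 1 (f : L1 n) = uHalf n (g : L1 n) := fun g => by
    obtain ⟨l, a, h⟩ := g.2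
    exact (hC g l a h).imp fun f hf => hf.1
  choose T hT using hex
  refine ⟨{ toFun := T, map_add' := fun g g' => ?_, map_smul' := fun c g => ?_ }, hT, C + 1,
    fun g => ?_⟩
  · refine Subtype.ext (toTemperedDistributionCLM_injective ?_)
    rw [hT, Submodule.coe_add, Submodule.coe_add, map_add, map_add, hT, hT]
  · refine Subtype.ext (toTemperedDistributionCLM_injective ?_)
    rw [hT, Submodule.coe_smul, RingHom.id_apply, Submodule.coe_smul, map_smul, map_smul, hT]
  -- The constant `C + 1` is positive, so that it can be moved across the infimum.
  · have hC1 : (0 : ℝ) < C + 1 := by positivity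
    rw [← div_le_iff₀' hC1]
    obtain ⟨l, a, h⟩ := g.2
    refine le_csInf ⟨_, l, a, h, rfl⟩ ?_
    rintro s ⟨l, a, h, rfl⟩
    obtain ⟨f, hf, hfn⟩ := hC g l a h
    have hfT : T g = f := Subtype.ext (toTemperedDistributionCLM_injective ((hT g).trans hf.symm))
    have hs : 0 ≤ ∑' j, ‖l j‖ := tsum_nonneg fun _ => norm_nonneg _
    rw [div_le_iff₀' hC1]
    change hardyNorm (T g) ≤ _
    rw [hfT]
    linarith

theorem uHalf_injective (hn : 1 ≤ n) : Function.Injective (uHalf n) := by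
  have : Nonempty (Fin n) := ⟨⟨0, hn⟩⟩
  refine (injective_iff_map_eq_zero (uHalf n)).2 fun g hg => ?_
  have h0 : Lp.toTemperedDistributionCLM ℂ volume 1 (0 : L1 n) = uHalf n g := by rw [hg, map_zero]
  have h1 := (toTemperedDistributionCLM_eq_fourierMultiplier_iff _ _ _).1 h0
  -- The symbol vanishes only at the origin, so `𝓕 g` vanishes almost everywhere.
  have h2 : ((0 : Lp ℂ ∞ (volume : Measure (EuclideanSpace ℝ (Fin n)))) : _ → ℂ) =ᵐ[volume]
      𝓕 (g : EuclideanSpace ℝ (Fin n) → ℂ) := by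
    filter_upwards [h1, Lp.coeFn_zero ℂ ∞ (volume : Measure (EuclideanSpace ℝ (Fin n))),
      Measure.ae_ne volume (0 : EuclideanSpace ℝ (Fin n))] with ξ e1 e2 e3
    rw [Real.fourier_congr_ae (Lp.coeFn_zero _ _ _)] at e1
    have e4 : 𝓕 (0 : EuclideanSpace ℝ (Fin n) → ℂ) ξ = 0 := by simp [Real.fourier_eq]
    rw [e4] at e1
    rw [e2, Pi.zero_apply]
    exact ((smul_eq_zero.1 e1.symm).resolve_right (uHalfSymbol_ne_zero e3)).symm
  have h3 := fourier_toTemperedDistributionCLM_one g h2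
  rw [map_zero] at h3
  refine toTemperedDistributionCLM_injective ?_
  rw [map_zero, ← fourierInv_fourier_eq (F := 𝓢'(EuclideanSpace ℝ (Fin n), ℂ))
    (Lp.toTemperedDistributionCLM ℂ volume 1 g), h3, fourierInv_zero]

end Operator

/-! ### A function in `H¹` outside the range of `𝓤^{1/2}` -/

section Witness
variable {n : ℕ}

theorem eq_zero_of_forall_pos {u : ℝ → ℂ} (hu : Continuous u) (h : ∀ t, 0 < t → u t = 0) :
    u 0 = 0 := by
  have hc : IsClosed {t | u t = 0} := isClosed_eq hu continuous_const
  have : closure (Set.Ioi (0 : ℝ)) ⊆ {t | u t = 0} := closure_minimal h hc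
  exact this (by simp)

/-- The function with Fourier transform `ξ_i e^{-s}` belongs to `H¹` and is not of the form
`𝓤^{1/2} g` with `g ∈ L¹`. -/
theorem exists_mem_H1_forall_ne (hn : 1 ≤ n) : ∃ f ∈ H1 n, ∀ g : L1 n,
    Lp.toTemperedDistributionCLM ℂ volume 1 f ≠ uHalf n g := by
  set i : Fin n := ⟨0, hn⟩
  have hT : (fun ξ : EuclideanSpace ℝ (Fin n) => ((ξ i : ℝ) : ℂ)).HasTemperateGrowth :=
    (Complex.ofRealCLM.comp (EuclideanSpace.proj (𝕜 := ℝ) i)).hasTemperateGrowth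
  obtain ⟨φ, hφ⟩ := exists_schwartzMap_fourier_eq hT
  obtain ⟨χ, hχ⟩ := exists_schwartzMap_fourier_eq (hT.smul (hasTemperateGrowth_gradSymbol n))
  -- `ψ` represents the Riesz transform: its Fourier transform is `e^{-s} s^{-1/2} ξ_i (2πi ξ)`.
  obtain ⟨ψ, hψ, hψA⟩ := (isProfile_schwartzMap χ).exists_div_sqrt (fun t _ ξ => by
    simp only [Pi.smul_apply', PiLp.smul_apply, smul_eq_mul, map_smul, Complex.ofReal_mul]
    rw [← Complex.coe_smul, ← Complex.coe_smul, smul_smul, smul_smul]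
    push_cast
    ring_nf) hχ
  have hφ1 := (φ.memLp 1 (μ := (volume : Measure (EuclideanSpace ℝ (Fin n)))))
  have hψ1 : MemLp ψ 1 volume := memLp_one_iff_integrable.2 hψ.integrable
  have hF : ∀ ξ, 𝓕 (hφ1.toLp : EuclideanSpace ℝ (Fin n) → ℂ) ξ =
      Real.exp (-lapSymbol ξ) • ((ξ i : ℝ) : ℂ) := fun ξ => by
    rw [Real.fourier_congr_ae hφ1.coeFn_toLp, hφ]
  refine ⟨hφ1.toLp, ⟨hψ1.toLp, ?_⟩, fun g hg => ?_⟩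
  · refine (toTemperedDistributionCLM_eq_fourierMultiplier_iff _ _ _).2
      (Filter.Eventually.of_forall fun ξ => ?_)
    rw [hF, Real.fourier_congr_ae hψ1.coeFn_toLp, hψA, rieszSymbol_eq, smul_assoc,
      smul_comm (ξ i : ℂ), Pi.smul_apply']
  · have h1 := (toTemperedDistributionCLM_eq_fourierMultiplier_iff _ _ _).1 hg
    have hgc : Continuous (𝓕 (g : EuclideanSpace ℝ (Fin n) → ℂ)) :=
      (Real.Lp.fourierTransform g).continuous
    have h2 : ∀ ξ, Real.exp (-lapSymbol ξ) • ((ξ i : ℝ) : ℂ) =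
        𝓕 (g : EuclideanSpace ℝ (Fin n) → ℂ) ξ • uHalfSymbol ξ := by
      have hl : Continuous (𝓕 (hφ1.toLp : EuclideanSpace ℝ (Fin n) → ℂ)) :=
        (Real.Lp.fourierTransform hφ1.toLp).continuous
      have := (hl.ae_eq_iff_eq volume (hgc.smul continuous_uHalfSymbol)).1 h1
      exact fun ξ => (hF ξ).symm.trans (congrFun this ξ)
    set e : EuclideanSpace ℝ (Fin n) := EuclideanSpace.single i 1
    set h : ℝ → ℂ := fun t => 𝓕 (g : EuclideanSpace ℝ (Fin n) → ℂ) (t • e)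
    have hc : Continuous h := hgc.comp (by fun_prop)
    have hne : ∀ t : ℝ, ‖t • e‖ = |t| := fun t => by
      rw [norm_smul, PiLp.norm_single, norm_one, mul_one, Real.norm_eq_abs]
    have hlap : ∀ t : ℝ, lapSymbol (t • e) = (2 * Real.pi * t) ^ 2 := fun t => by
      rw [lapSymbol, hne, mul_pow, sq_abs]
      ring
    -- Along the `i`-th axis the equation reads `w(t) t = 2π |t| 𝓕 g (t e)`, so `𝓕 g (t e)` tends to
    -- `± 1 / (2π)` as `t → 0±`.
    set w : ℝ → ℝ := fun t => Real.exp (-(2 * Real.pi * t) ^ 2) * √(1 + (2 * Real.pi * t) ^ 2)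
    have hw : Continuous w := by fun_prop
    have h3 : ∀ t : ℝ, (w t : ℂ) * t = h t * (2 * Real.pi * |t| : ℝ) := by
      intro t
      have h4 := h2 (t • e)
      have h5 : (√(1 + (2 * Real.pi * t) ^ 2) : ℂ) ≠ 0 := by
        exact_mod_cast (Real.sqrt_pos.2 (by positivity : 0 < 1 + (2 * Real.pi * t) ^ 2)).ne'
      have h6 : (t • e) i = t := by simp [e]
      rw [uHalfSymbol_eq, sqrt_lapSymbol, hne, hlap, h6, Complex.real_smul, Complex.real_smul,
        smul_eq_mul, Complex.ofReal_inv, mul_left_comm, eq_inv_mul_iff_mul_eq₀ h5] at h4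
      rw [Complex.ofReal_mul, ← h4]
      ring
    have hpos : ∀ t, 0 < t → h t * (2 * Real.pi) - w t = 0 := fun t ht => by
      have := h3 t
      rw [abs_of_pos ht] at this
      have ht' : (t : ℂ) ≠ 0 := by exact_mod_cast ht.ne'
      apply mul_right_cancel₀ ht'
      push_cast at this
      linear_combination -this
    have hneg : ∀ t, 0 < t → h (-t) * (2 * Real.pi) + w t = 0 := fun t ht => by
      have := h3 (-t)
      rw [abs_neg, abs_of_pos ht] at this
      have hwt : w (-t) = w t := by simp [w]
      have ht' : (t : ℂ) ≠ 0 := by exact_mod_cast ht.ne'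
      apply mul_right_cancel₀ ht'
      rw [hwt] at this
      push_cast at this
      linear_combination -this
    have e1 := eq_zero_of_forall_pos (u := fun t => h t * (2 * Real.pi) - w t) (by fun_prop) hpos
    have e2 := eq_zero_of_forall_pos (u := fun t => h (-t) * (2 * Real.pi) + w t) (by fun_prop) hneg
    have hw0 : w 0 = 1 := by simp [w]
    simp only [neg_zero, hw0] at e1 e2
    have : (2 : ℂ) = 0 := by push_cast at e1 e2; linear_combination e2 - e1
    norm_num at this

end Witness

end EuclideanHardy

end

theorem mainTheorem9 (n : ℕ) (hn : 1 ≤ n) :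
    (∃ T : EuclideanHardy.goldberg n →ₗ[ℂ] EuclideanHardy.H1 n,
      (∀ g : EuclideanHardy.goldberg n,
        Lp.toTemperedDistributionCLM ℂ volume 1 (T g : EuclideanHardy.L1 n)
          = EuclideanHardy.uHalf n (g : EuclideanHardy.L1 n)) ∧
      (∃ C : ℝ, ∀ g : EuclideanHardy.goldberg n,
        EuclideanHardy.hardyNorm (T g) ≤ C * EuclideanHardy.goldbergNorm g) ∧
      Function.Injective T ∧
      ¬ Function.Surjective T) ∧
    {f : EuclideanHardy.L1 n | ∃ g ∈ EuclideanHardy.goldberg n,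
      Lp.toTemperedDistributionCLM ℂ volume 1 f = EuclideanHardy.uHalf n g}
        ⊂ (EuclideanHardy.H1 n : Set (EuclideanHardy.L1 n)) := by
  obtain ⟨T, hT, hbound⟩ := EuclideanHardy.exists_linearMap_uHalf n
  obtain ⟨f, hf, hne⟩ := EuclideanHardy.exists_mem_H1_forall_ne hn
  refine ⟨⟨T, hT, hbound, fun g g' h => ?_, fun h => ?_⟩, ?_⟩
  · refine Subtype.ext (EuclideanHardy.uHalf_injective hn ?_)
    rw [← hT, ← hT, h]
  · obtain ⟨g, hg⟩ := h ⟨f, hf⟩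
    exact hne g (by rw [← hT, hg])
  · refine Set.ssubset_iff_subset_ne.2 ⟨?_, fun h => ?_⟩
    · rintro f' ⟨g, hg, hfg⟩
      rw [EuclideanHardy.toTemperedDistributionCLM_injective (hfg.trans (hT ⟨g, hg⟩).symm)]
      exact (T ⟨g, hg⟩).2
    · obtain ⟨g, -, hfg⟩ := h.symm.subset hf
      exact hne g hfg
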